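/- Let $X=(X_t)_{t\ge 0}$ be a real-valued Lévy process on a probability space $(\Omega,\mathscr F,\mathbb P)$ with Lévy triplet $(b,\sigma^2,\nu)$ (with respect to the truncation function $z\mathbf 1_{\{|z|\le 1\}}$), that is, $$\mathbb E\big(e^{iuX_t}\big)=\exp\bigg(t\Big(ibu-\frac{\sigma^2u^2}{2}+\int_{\mathbb R\setminus\{0\}}\big(e^{iuz}-1-iuz\mathbf 1_{\{|z|\le 1\}}\big)\,\nu(dz)\Big)\bigg),\qquad t\ge 0,\ u\in\mathbb R,$$ where $\nu$ is a Lévy measure, i.e. $\nu(\{0\})=0$ and $\int \min(1,z^2)\,\nu(dz)<\infty$. Assume that $(e^{X_t})_{t\ge0}$ is a martingale in the sense that $$\int_{(1,\infty)}e^z\,\nu(dz)<\infty\quad\text{and}\quad b=-\frac{\sigma^2}{2}-\int_{\mathbb R\setminus\{0\}}\big(e^z-1-z\mathbf 1_{\{|z|\le1\}}\big)\,\nu(dz).$$ Let $r\ge 0$ (interest rate), $\delta\ge 0$ (dividend yield), $K>0$ (strike) and $T>0$ (maturity). For $t\in[0,T]$ and $s\ge 0$ let $$P_e(t,s)=\mathbb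 E\Big(e^{-r(T-t)}\big(K-s\,e^{(r-\delta)(T-t)+X_{T-t}}\big)^+\Big)$$ be the European put price, let $$b_e(t)=\inf\big\{s\ge 0:\ P_e(t,s)>(K-s)^+\big\}$$ be the European critical price, and set $\zeta(\tau)=K/b_e(T-\tau)-1$ for $\tau\in(0,T]$. Let $$d=r-\delta-\int_{(0,\infty)}(e^z-1)\,\nu(dz)\in[-\infty,\infty).$$ If $\sigma>0$ and $d>0$, then $$\lim_{\tau\to0^+}\frac{\zeta(\tau)}{\sqrt{-\tau\ln\tau}}=\sigma.$$ -/

import Mathlib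

open MeasureTheory ProbabilityTheory Filter Topology Set
open scoped NNReal ENNReal

noncomputable section

namespace ExpLevy

/-- `ν` is a Lévy measure on `ℝ`: no mass at the origin and `∫ min(1, z²) ν(dz) < ∞`. -/
structure IsLevyMeasure (ν : Measure ℝ) : Prop where
  zero : ν {0} = 0
  lintegral_lt_top : ∫⁻ z, ENNReal.ofReal (min 1 (z ^ 2)) ∂ν < ∞

/-- The Lévy–Khintchine exponent of the triplet `(b, σ², ν)`, with truncation function
`z ↦ z 1_{|z| ≤ 1}`:
`ψ(u) = i b u - σ² u² / 2 + ∫ (e^{iuz} - 1 - i u z 1_{|z| ≤ 1}) ν(dz)`. -/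
def levyExponent (b sigmaSq : ℝ) (ν : Measure ℝ) (u : ℝ) : ℂ :=
  Complex.I * b * u - sigmaSq * u ^ 2 / 2
    + ∫ z : ℝ, (Complex.exp (Complex.I * u * z) - 1
        - Complex.I * u * ((if |z| ≤ 1 then z else 0 : ℝ) : ℂ)) ∂ν

/-- `X` is a real-valued Lévy process on `[0, ∞)` under `P`. -/
structure IsLevyProcess {Ω : Type*} [MeasurableSpace Ω] (X : ℝ≥0 → Ω → ℝ) (P : Measure Ω) :
    Prop where
  measurable : ∀ t, Measurable (X t)
  start : ∀ᵐ ω ∂P, X 0 ω = 0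
  indep : HasIndepIncrements X P
  stationary : ∀ s t : ℝ≥0, IdentDistrib (fun ω => X (s + t) ω - X s ω) (X t) P P
  stochContinuous : ∀ t : ℝ≥0, TendstoInMeasure P X (𝓝 t) (X t)
  cadlag : ∀ᵐ ω ∂P, ∀ t : ℝ≥0, ContinuousWithinAt (fun s => X s ω) (Ici t) t ∧
    ∃ l : ℝ, Tendsto (fun s => X s ω) (𝓝[<] t) (𝓝 l)

/-- `X` is a Lévy process with Lévy triplet `(b, σ², ν)`: `ν` is a Lévy measure and
`E e^{iuX_t} = e^{t ψ(u)}` for all `t ≥ 0` and `u ∈ ℝ`. -/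
structure IsLevyProcessWithTriplet {Ω : Type*} [MeasurableSpace Ω] (X : ℝ≥0 → Ω → ℝ)
    (P : Measure Ω) (b sigmaSq : ℝ) (ν : Measure ℝ) : Prop where
  isLevyProcess : IsLevyProcess X P
  isLevyMeasure : IsLevyMeasure ν
  charFun_eq : ∀ (t : ℝ≥0) (u : ℝ),
    charFun (P.map (X t)) u = Complex.exp ((t : ℝ) * levyExponent b sigmaSq ν u)

/-- The conditions on the triplet under which `(e^{X_t})` is a martingale:
`∫_{z > 1} e^z ν(dz) < ∞` and `b = -σ²/2 - ∫ (e^z - 1 - z 1_{|z| ≤ 1}) ν(dz)`. -/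
structure MartingaleCondition (b sigmaSq : ℝ) (ν : Measure ℝ) : Prop where
  exp_moment : ∫⁻ z in Ioi (1 : ℝ), ENNReal.ofReal (Real.exp z) ∂ν < ∞
  drift : b = -sigmaSq / 2 - ∫ z : ℝ, (Real.exp z - 1 - (if |z| ≤ 1 then z else 0)) ∂ν

/-- `d = r - δ - ∫_{(0,∞)} (e^z - 1) ν(dz)`, an extended real number: it is `-∞` if the
integral diverges. -/
def dConst (r δ : ℝ) (ν : Measure ℝ) : EReal :=
  ((r - δ : ℝ) : EReal)
    - ((∫⁻ z in Ioi (0 : ℝ), ENNReal.ofReal (Real.exp z - 1) ∂ν : ℝ≥0∞) : EReal)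

/-- The European put price
`P_e(t, s) = E[e^{-r(T-t)} (K - s e^{(r-δ)(T-t) + X_{T-t}})⁺]`, for `t ≤ T` and `s ≥ 0`. -/
def euroPut {Ω : Type*} [MeasurableSpace Ω] (X : ℝ≥0 → Ω → ℝ) (P : Measure Ω)
    (r δ K T t s : ℝ) : ℝ :=
  ∫ ω, Real.exp (-r * (T - t)) *
    max (K - s * Real.exp ((r - δ) * (T - t) + X (T - t).toNNReal ω)) 0 ∂P

/-- The European critical price `b_e(t) = inf {s ≥ 0 : P_e(t, s) > (K - s)⁺}`. -/
def euroCritPrice {Ω : Type*} [MeasurableSpace Ω] (X : ℝ≥0 → Ω → ℝ) (P : Measure Ω)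
    (r δ K T t : ℝ) : ℝ :=
  sInf {s : ℝ | 0 ≤ s ∧ max (K - s) 0 < euroPut X P r δ K T t s}

/-- `ζ(τ) = K / b_e(T - τ) - 1`. -/
def zeta {Ω : Type*} [MeasurableSpace Ω] (X : ℝ≥0 → Ω → ℝ) (P : Measure Ω)
    (r δ K T τ : ℝ) : ℝ :=
  K / euroCritPrice X P r δ K T (T - τ) - 1

end ExpLevy

end

/-!
The critical price lies at log-distance of order `√(-τ ln τ)` below the strike, and the question is
for which `a` the put price `P_e` at log-distance `a √(-τ ln τ)` exceeds `K - s`. Delete the jumps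
of size at most `ε` and let `ε → 0`: the log-return becomes an independent sum of a Gaussian
variable and two compound Poisson variables carrying the downward and the upward jumps, each
compensated so that its exponential has mean one.

* By Jensen's inequality such a mean-one factor can only increase the price of a put, so the price
  is at least that of the purely Gaussian put. The time value of the latter is at least
  `τ ^ (a² / (2σ²) + 1/2)` up to logarithmic factors, which for `a < σ` exceeds the terms of order
  `τ` coming from interest and dividends.
* Dropping the upward jumps while keeping their compensator can only increase the price of a put;
  the remaining drift `d > 0` then lowers it by a term of order `τ`. Without upward jumps all
  exponential moments of order `θ > 0` are finite, with cumulant `~ σ² θ² / 2` as `θ → ∞`, and the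
  Chernoff bound with `θ` of order `√(-τ ln τ) / τ` makes the time value `o(τ)` as soon as `a > σ`.
-/

noncomputable section

namespace ExpLevy

section ExponentialMoment

/-- The exponential moment `∫ e^{zx} μ(dx)` of complex order `z` converges absolutely and
equals `w`. -/
structure HasExpMoment (μ : Measure ℝ) (z w : ℂ) : Prop where
  integrable : Integrable (fun x : ℝ => Complex.exp (z * x)) μ
  complexMGF_eq : complexMGF id μ z = w

variable {μ ρ : Measure ℝ} {z w w' : ℂ}

lemma HasExpMoment.integral_eq (h : HasExpMoment μ z w) :
    ∫ x : ℝ, Complex.exp (z * x) ∂μ = w :=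
  h.complexMGF_eq

lemma HasExpMoment.charFun_eq {u : ℝ} (h : HasExpMoment μ (u * Complex.I) w) :
    charFun μ u = w := by
  rw [← complexMGF_id_mul_I, h.complexMGF_eq]

lemma hasExpMoment_ofReal {θ m : ℝ} : HasExpMoment μ θ m ↔
    Integrable (fun x => Real.exp (θ * x)) μ ∧ ∫ x, Real.exp (θ * x) ∂μ = m := by
  have hcast : (fun x : ℝ => Complex.exp (θ * x)) = fun x : ℝ => (Real.exp (θ * x) : ℂ) := by
    ext; simp
  constructor
  · rintro ⟨hint, heq⟩
    rw [hcast] at hint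
    exact ⟨hint.re, by simpa [complexMGF_ofReal, mgf] using heq⟩
  · rintro ⟨hint, heq⟩
    exact ⟨hcast ▸ hint.ofReal, by simpa [complexMGF_ofReal, mgf] using heq⟩

lemma hasExpMoment_one : HasExpMoment μ 1 1 ↔ Integrable Real.exp μ ∧ ∫ x, Real.exp x ∂μ = 1 := by
  simpa using hasExpMoment_ofReal (μ := μ) (θ := 1) (m := 1)

lemma hasExpMoment_zero (μ : Measure ℝ) [IsFiniteMeasure μ] : HasExpMoment μ 0 (μ.real univ) :=
  ⟨by simp, by simp [complexMGF]⟩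

lemma HasExpMoment.conv [SFinite μ] [SFinite ρ] (h : HasExpMoment μ z w)
    (h' : HasExpMoment ρ z w') : HasExpMoment (μ ∗ ρ) z (w * w') := by
  have hmul (x y : ℝ) : Complex.exp (z * ((x + y : ℝ) : ℂ))
      = Complex.exp (z * x) * Complex.exp (z * y) := by
    rw [← Complex.exp_add, Complex.ofReal_add, mul_add]
  have hint : Integrable (fun x : ℝ => Complex.exp (z * x)) (μ ∗ ρ) := by
    unfold Measure.conv
    rw [integrable_map_measure (by fun_prop) (by fun_prop)]
    exact (h.integrable.mul_prod h'.integrable).congr (ae_of_all _ fun p => (hmul p.1 p.2).symm)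
  refine ⟨hint, ?_⟩
  change ∫ x : ℝ, Complex.exp (z * x) ∂(μ ∗ ρ) = w * w'
  simp_rw [integral_conv hint, hmul, integral_const_mul, integral_mul_const, h.integral_eq,
    h'.integral_eq]

lemma hasExpMoment_dirac (a : ℝ) (z : ℂ) :
    HasExpMoment (Measure.dirac a) z (Complex.exp (z * a)) :=
  ⟨integrable_dirac (by simp), by simp [complexMGF]⟩

lemma hasExpMoment_gaussianReal (m : ℝ) (v : ℝ≥0) (z : ℂ) :
    HasExpMoment (gaussianReal m v) z (Complex.exp (z * m + v * z ^ 2 / 2)) := by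
  refine ⟨(integrable_norm_iff (by fun_prop)).1 ?_, complexMGF_id_gaussianReal z⟩
  simpa [Complex.norm_exp] using integrable_exp_mul_gaussianReal (μ := m) (v := v) z.re

end ExponentialMoment

section CompoundPoisson

variable {κ : Measure ℝ} {z w : ℂ}

/-- The `k`-fold convolution of `κ` with itself. -/
def convPow (κ : Measure ℝ) : ℕ → Measure ℝ
  | 0 => Measure.dirac 0
  | k + 1 => κ ∗ convPow κ k

instance isFiniteMeasure_convPow (κ : Measure ℝ) [IsFiniteMeasure κ] (k : ℕ) :
    IsFiniteMeasure (convPow κ k) := by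
  induction k with
  | zero => unfold convPow; infer_instance
  | succ k ih => unfold convPow; infer_instance

lemma HasExpMoment.convPow [IsFiniteMeasure κ] (h : HasExpMoment κ z w) (k : ℕ) :
    HasExpMoment (convPow κ k) z (w ^ k) := by
  induction k with
  | zero => simpa [ExpLevy.convPow] using hasExpMoment_dirac 0 z
  | succ k ih => rw [pow_succ']; exact h.conv ih

lemma ae_nonneg_convPow (h : ∀ᵐ x ∂κ, 0 ≤ x) (k : ℕ) :
    ∀ᵐ x ∂(convPow κ k), 0 ≤ x := by
  induction k with
  | zero => simp [convPow]
  | succ k ih =>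
    unfold convPow Measure.conv
    rw [ae_map_iff (by fun_prop) (measurableSet_Ici (a := (0 : ℝ)))]
    filter_upwards [Measure.quasiMeasurePreserving_fst.ae h,
      Measure.quasiMeasurePreserving_snd.ae ih] with p hp hq using add_nonneg hp hq

/-- The compound Poisson law `e^{-κ(ℝ)} ∑ₖ κ^{∗k} / k!` with finite jump intensity `κ`. -/
def compoundPoisson (κ : Measure ℝ) : Measure ℝ :=
  Measure.sum fun k : ℕ =>
    ENNReal.ofReal (Real.exp (-κ.real univ) / (k.factorial : ℝ)) • convPow κ k

lemma ae_nonneg_compoundPoisson (h : ∀ᵐ x ∂κ, 0 ≤ x) :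
    ∀ᵐ x ∂(compoundPoisson κ), 0 ≤ x := by
  rw [compoundPoisson, Measure.ae_sum_iff' (measurableSet_Ici (a := (0 : ℝ)))]
  exact fun k => Measure.ae_smul_measure (ae_nonneg_convPow h k) _

lemma HasExpMoment.integral_norm_convPow [IsFiniteMeasure κ] (h : HasExpMoment κ z w) (k : ℕ) :
    ∫ x : ℝ, ‖Complex.exp (z * x)‖ ∂(ExpLevy.convPow κ k)
      = (∫ x : ℝ, ‖Complex.exp (z * x)‖ ∂κ) ^ k := by
  have hnorm (x : ℝ) : ‖Complex.exp (z * x)‖ = Real.exp (z.re * x) := by simp [Complex.norm_exp]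
  have hre : HasExpMoment κ z.re ((∫ x : ℝ, ‖Complex.exp (z * x)‖ ∂κ : ℝ) : ℂ) :=
    hasExpMoment_ofReal.2 ⟨by simpa only [hnorm] using h.integrable.norm, by simp only [hnorm]⟩
  simp only [hnorm] at hre ⊢
  exact (hasExpMoment_ofReal.1 (by simpa only [Complex.ofReal_pow] using hre.convPow k)).2

lemma HasExpMoment.integrable_compoundPoisson [IsFiniteMeasure κ] (h : HasExpMoment κ z w) :
    Integrable (fun x : ℝ => Complex.exp (z * x)) (compoundPoisson κ) := by
  refine integrable_sum_measure
    (fun k => (h.convPow k).integrable.smul_measure ENNReal.ofReal_ne_top) ?_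
  have hterm (k : ℕ) : ∫ x : ℝ, ‖Complex.exp (z * x)‖
      ∂(ENNReal.ofReal (Real.exp (-κ.real univ) / k.factorial) • ExpLevy.convPow κ k)
      = Real.exp (-κ.real univ) *
        ((∫ x : ℝ, ‖Complex.exp (z * x)‖ ∂κ) ^ k / k.factorial) := by
    rw [integral_smul_measure, h.integral_norm_convPow, ENNReal.toReal_ofReal (by positivity),
      smul_eq_mul, div_mul_eq_mul_div, mul_div_assoc]
  simp_rw [hterm]
  exact (Real.summable_pow_div_factorial _).mul_left _

lemma HasExpMoment.compoundPoisson [IsFiniteMeasure κ] (h : HasExpMoment κ z w) :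
    HasExpMoment (compoundPoisson κ) z (Complex.exp (w - κ.real univ)) := by
  refine ⟨h.integrable_compoundPoisson, ?_⟩
  refine (hasSum_integral_measure h.integrable_compoundPoisson).unique ?_
  have hterm (k : ℕ) : ∫ x : ℝ, Complex.exp (z * x)
      ∂(ENNReal.ofReal (Real.exp (-κ.real univ) / k.factorial) • ExpLevy.convPow κ k)
      = Complex.exp (-κ.real univ) * (w ^ k / k.factorial) := by
    rw [integral_smul_measure, (h.convPow k).integral_eq, ENNReal.toReal_ofReal (by positivity),
      Complex.real_smul]
    push_cast
    ring
  simp_rw [hterm, sub_eq_neg_add, Complex.exp_add, Complex.exp_eq_exp_ℂ]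
  exact (NormedSpace.expSeries_div_hasSum_exp w).mul_left _

instance isProbabilityMeasure_compoundPoisson (κ : Measure ℝ) [IsFiniteMeasure κ] :
    IsProbabilityMeasure (compoundPoisson κ) := by
  have hmass := (hasExpMoment_zero κ).compoundPoisson
  refine ⟨(ENNReal.toReal_eq_one_iff _).1 ?_⟩
  simpa [complexMGF, Measure.real] using hmass.complexMGF_eq

/-- The function of jump sizes whose `κ`-integral is the cumulant exponent, at complex order `z`,
of a compound Poisson law with jump intensity `κ` shifted so that its exponential has mean one. -/
def compensatedExp (z : ℂ) (x : ℝ) : ℂ :=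
  Complex.exp (z * x) - 1 - z * ((Real.exp x - 1 : ℝ) : ℂ)

/-- The compound Poisson law with jump intensity `κ`, shifted so that its exponential has mean
one. -/
def expCompensatedPoisson (κ : Measure ℝ) : Measure ℝ :=
  Measure.dirac (-∫ x, (Real.exp x - 1) ∂κ) ∗ compoundPoisson κ

instance isProbabilityMeasure_expCompensatedPoisson (κ : Measure ℝ) [IsFiniteMeasure κ] :
    IsProbabilityMeasure (expCompensatedPoisson κ) := by
  unfold expCompensatedPoisson; infer_instance

lemma hasExpMoment_expCompensatedPoisson [IsFiniteMeasure κ]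
    (hz : Integrable (fun x : ℝ => Complex.exp (z * x)) κ) (hexp : Integrable Real.exp κ) :
    HasExpMoment (expCompensatedPoisson κ) z (Complex.exp (∫ x, compensatedExp z x ∂κ)) := by
  have hjump : Integrable (fun x : ℝ => Complex.exp (z * x) - 1) κ := hz.sub (integrable_const 1)
  have hcompensator : Integrable (fun x : ℝ => ((Real.exp x - 1 : ℝ) : ℂ)) κ :=
    (hexp.sub (integrable_const 1)).ofReal
  have hexponent : ∫ x, compensatedExp z x ∂κ = z * ((-∫ x, (Real.exp x - 1) ∂κ : ℝ) : ℂ)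
      + ((∫ x : ℝ, Complex.exp (z * x) ∂κ) - κ.real univ) := by
    unfold compensatedExp
    rw [integral_sub hjump (hcompensator.const_mul z), integral_const_mul, integral_complex_ofReal,
      integral_sub hz (integrable_const 1)]
    simp only [integral_const, Complex.real_smul, mul_one, Complex.ofReal_neg]
    ring
  rw [hexponent, Complex.exp_add]
  exact (hasExpMoment_dirac _ z).conv (HasExpMoment.mk hz rfl).compoundPoisson

lemma hasExpMoment_expCompensatedPoisson_one [IsFiniteMeasure κ] (hexp : Integrable Real.exp κ) :
    HasExpMoment (expCompensatedPoisson κ) 1 1 := by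
  have hzero : compensatedExp 1 = 0 := by ext x; simp [compensatedExp]
  simpa [hzero] using hasExpMoment_expCompensatedPoisson (z := 1)
    (by simpa using hexp.ofReal (𝕜 := ℂ)) hexp

end CompoundPoisson

section Put

/-- The payoff of a put with strike one on an asset whose log-price is `w`. -/
def putPayoff (w : ℝ) : ℝ := max (1 - Real.exp w) 0

/-- The undiscounted price of a put with strike one on an asset with current log-price `a`, when the
log-return up to maturity has law `μ`. -/
def putPrice (μ : Measure ℝ) (a : ℝ) : ℝ := ∫ x, putPayoff (a + x) ∂μ

lemma putPayoff_nonneg (w : ℝ) : 0 ≤ putPayoff w := le_max_right _ _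

lemma putPayoff_le_one (w : ℝ) : putPayoff w ≤ 1 :=
  max_le (sub_le_self _ (Real.exp_pos w).le) zero_le_one

@[fun_prop]
lemma continuous_putPayoff : Continuous putPayoff := by unfold putPayoff; fun_prop

lemma antitone_putPayoff : Antitone putPayoff := fun _ _ hab =>
  max_le_max_right _ (sub_le_sub_left (Real.exp_le_exp.2 hab) _)

lemma norm_putPayoff_le_one (w : ℝ) : ‖putPayoff w‖ ≤ 1 := by
  rw [Real.norm_of_nonneg (putPayoff_nonneg w)]
  exact putPayoff_le_one w

lemma one_add_mul_exp_sub_one_le_exp_mul {θ : ℝ} (hθ : 1 ≤ θ) (x : ℝ) :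
    1 + θ * (Real.exp x - 1) ≤ Real.exp (θ * x) := by
  have hbernoulli := one_add_mul_self_le_rpow_one_add (s := Real.exp x - 1)
    (by linarith [Real.exp_pos x]) hθ
  rwa [add_sub_cancel, ← Real.exp_mul, mul_comm x] at hbernoulli

lemma putPayoff_le_add_exp_mul_div {θ : ℝ} (hθ : 1 ≤ θ) (w : ℝ) :
    putPayoff w ≤ 1 - Real.exp w + Real.exp (θ * w) / θ := by
  have hθ0 : 0 < θ := zero_lt_one.trans_le hθ
  have hcall : Real.exp w - 1 ≤ Real.exp (θ * w) / θ := by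
    rw [le_div_iff₀ hθ0]
    linarith [one_add_mul_exp_sub_one_le_exp_mul hθ w]
  exact max_le (le_add_of_nonneg_right (by positivity)) (by linarith)

lemma add_indicator_Ici_le_putPayoff (h w : ℝ) :
    1 - Real.exp w + (Ici h).indicator (fun _ => h) w ≤ putPayoff w := by
  by_cases hw : w ∈ Ici h
  · rw [indicator_of_mem hw]
    refine le_max_of_le_right ?_
    linarith [Real.add_one_le_exp w, mem_Ici.1 hw]
  · rw [indicator_of_notMem hw, add_zero]
    exact le_max_left _ _

variable {μ ρ : Measure ℝ}

lemma integrable_putPayoff_add [IsFiniteMeasure μ] (a : ℝ) :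
    Integrable (fun x => putPayoff (a + x)) μ :=
  .of_bound (by fun_prop) 1 (ae_of_all _ fun _ => norm_putPayoff_le_one _)

lemma putPrice_nonneg (μ : Measure ℝ) (a : ℝ) : 0 ≤ putPrice μ a :=
  integral_nonneg fun _ => putPayoff_nonneg _

lemma antitone_putPrice [IsFiniteMeasure μ] : Antitone (putPrice μ) := fun _ _ hab =>
  integral_mono (integrable_putPayoff_add _) (integrable_putPayoff_add _) fun _ =>
    antitone_putPayoff (by gcongr)

lemma putPrice_le_one [IsProbabilityMeasure μ] (a : ℝ) : putPrice μ a ≤ 1 := by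
  calc putPrice μ a ≤ ∫ _, 1 ∂μ :=
        integral_mono (integrable_putPayoff_add a) (integrable_const 1) fun _ => putPayoff_le_one _
    _ = 1 := by simp

lemma integrable_putPrice_add [IsFiniteMeasure μ] [IsProbabilityMeasure ρ] (a : ℝ) :
    Integrable (fun x => putPrice ρ (a + x)) μ := by
  refine .of_bound (antitone_putPrice.measurable.comp (by fun_prop)).aestronglyMeasurable 1
    (ae_of_all _ fun x => ?_)
  rw [Real.norm_of_nonneg (putPrice_nonneg _ _)]
  exact putPrice_le_one _

lemma putPrice_conv [IsFiniteMeasure μ] [IsFiniteMeasure ρ] (a : ℝ) :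
    putPrice (μ ∗ ρ) a = ∫ x, putPrice ρ (a + x) ∂μ := by
  simp only [putPrice, integral_conv (integrable_putPayoff_add a), add_assoc]

lemma integrable_one_sub_exp_add [IsFiniteMeasure μ] (hμ : HasExpMoment μ 1 1) (a : ℝ) :
    Integrable (fun x => 1 - Real.exp (a + x)) μ := by
  simp only [Real.exp_add]
  exact (integrable_const 1).sub ((hasExpMoment_one.1 hμ).1.const_mul _)

lemma integral_one_sub_exp_add [IsProbabilityMeasure μ] (hμ : HasExpMoment μ 1 1) (a : ℝ) :
    ∫ x, (1 - Real.exp (a + x)) ∂μ = 1 - Real.exp a := by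
  obtain ⟨hint, hmean⟩ := hasExpMoment_one.1 hμ
  simp only [Real.exp_add]
  rw [integral_sub (integrable_const _) (hint.const_mul _), integral_const_mul, hmean]
  simp

lemma putPayoff_le_putPrice [IsProbabilityMeasure μ] (hμ : HasExpMoment μ 1 1) (a : ℝ) :
    putPayoff a ≤ putPrice μ a := by
  refine max_le ?_ (putPrice_nonneg _ _)
  rw [← integral_one_sub_exp_add hμ]
  exact integral_mono (integrable_one_sub_exp_add hμ a) (integrable_putPayoff_add a) fun _ =>
    le_max_left _ _

lemma putPrice_le_putPrice_conv [IsFiniteMeasure μ] [IsProbabilityMeasure ρ]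
    (hρ : HasExpMoment ρ 1 1) (a : ℝ) : putPrice μ a ≤ putPrice (μ ∗ ρ) a := by
  rw [putPrice_conv]
  exact integral_mono (integrable_putPayoff_add a) (integrable_putPrice_add a) fun _ =>
    putPayoff_le_putPrice hρ _

lemma putPrice_le_putPayoff_of_ae_nonneg [IsProbabilityMeasure μ] (hμ : ∀ᵐ x ∂μ, 0 ≤ x) (a : ℝ) :
    putPrice μ a ≤ putPayoff a := by
  calc putPrice μ a ≤ ∫ _, putPayoff a ∂μ := by
        refine integral_mono_ae (integrable_putPayoff_add a) (integrable_const _) ?_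
        filter_upwards [hμ] with x hx
        exact antitone_putPayoff (le_add_of_nonneg_right hx)
    _ = putPayoff a := by simp

lemma putPrice_conv_expCompensatedPoisson_le [IsFiniteMeasure μ] {κ : Measure ℝ} [IsFiniteMeasure κ]
    (hκ : ∀ᵐ x ∂κ, 0 ≤ x) (a : ℝ) :
    putPrice (μ ∗ expCompensatedPoisson κ) a ≤ putPrice μ (a - ∫ x, (Real.exp x - 1) ∂κ) := by
  rw [putPrice_conv]
  refine integral_mono (integrable_putPrice_add a) (integrable_putPayoff_add _) fun x => ?_
  calc putPrice (expCompensatedPoisson κ) (a + x)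
      = putPrice (compoundPoisson κ) (a + x + -∫ x, (Real.exp x - 1) ∂κ) := by
        rw [expCompensatedPoisson, putPrice_conv, integral_dirac]
    _ ≤ putPayoff (a + x + -∫ x, (Real.exp x - 1) ∂κ) :=
        putPrice_le_putPayoff_of_ae_nonneg (ae_nonneg_compoundPoisson hκ) _
    _ = putPayoff (a - (∫ x, (Real.exp x - 1) ∂κ) + x) := by ring_nf

lemma putPrice_le_of_hasExpMoment [IsProbabilityMeasure μ] (hμ : HasExpMoment μ 1 1) {θ m : ℝ}
    (hθ : 1 ≤ θ) (hm : HasExpMoment μ θ m) (a : ℝ) :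
    putPrice μ a ≤ 1 - Real.exp a + Real.exp (θ * a) * m / θ := by
  obtain ⟨hint, hmoment⟩ := hasExpMoment_ofReal.1 hm
  have hint' : Integrable (fun x => Real.exp (θ * (a + x)) / θ) μ := by
    simpa only [mul_add, Real.exp_add] using (hint.const_mul _).div_const θ
  calc putPrice μ a ≤ ∫ x, (1 - Real.exp (a + x) + Real.exp (θ * (a + x)) / θ) ∂μ :=
        integral_mono (integrable_putPayoff_add a) ((integrable_one_sub_exp_add hμ a).add hint')
          fun _ => putPayoff_le_add_exp_mul_div hθ _
    _ = 1 - Real.exp a + Real.exp (θ * a) * m / θ := by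
        rw [integral_add (integrable_one_sub_exp_add hμ a) hint', integral_one_sub_exp_add hμ]
        simp only [mul_add, Real.exp_add, integral_div, integral_const_mul, hmoment]

lemma add_mul_real_Ici_le_putPrice [IsProbabilityMeasure μ] (hμ : HasExpMoment μ 1 1)
    (h a : ℝ) : 1 - Real.exp a + h * μ.real (Ici (h - a)) ≤ putPrice μ a := by
  have hind (x : ℝ) : (Ici h).indicator (fun _ => h) (a + x)
      = (Ici (h - a)).indicator (fun _ => h) x := by
    simp only [indicator, mem_Ici, sub_le_iff_le_add']
  have hint : Integrable (fun x => (Ici h).indicator (fun _ => h) (a + x)) μ := by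
    simpa only [hind] using (integrable_const h).indicator measurableSet_Ici
  calc 1 - Real.exp a + h * μ.real (Ici (h - a))
      = ∫ x, (1 - Real.exp (a + x) + (Ici h).indicator (fun _ => h) (a + x)) ∂μ := by
        rw [integral_add (integrable_one_sub_exp_add hμ a) hint, integral_one_sub_exp_add hμ]
        simp only [hind, integral_indicator_const _ measurableSet_Ici, smul_eq_mul, mul_comm]
    _ ≤ putPrice μ a :=
        integral_mono ((integrable_one_sub_exp_add hμ a).add hint) (integrable_putPayoff_add a)
          fun _ => add_indicator_Ici_le_putPayoff h _

lemma mul_gaussianPDFReal_le_gaussianReal_real_Ici {m x h : ℝ} {v : ℝ≥0} (hv : v ≠ 0) (hx : m ≤ x)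
    (hh : 0 ≤ h) : h * gaussianPDFReal m v (x + h) ≤ (gaussianReal m v).real (Ici x) := by
  have hdecr : ∀ y ∈ Icc x (x + h), gaussianPDFReal m v (x + h) ≤ gaussianPDFReal m v y := by
    rintro y ⟨hxy, hyh⟩
    unfold gaussianPDFReal
    have hmy : 0 ≤ y - m := by linarith
    gcongr
  calc h * gaussianPDFReal m v (x + h) = ∫ _ in Icc x (x + h), gaussianPDFReal m v (x + h) := by
        simp [hh]
    _ ≤ ∫ y in Icc x (x + h), gaussianPDFReal m v y :=
        setIntegral_mono_on (by simp) (integrable_gaussianPDFReal m v).integrableOn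
          measurableSet_Icc hdecr
    _ = (gaussianReal m v).real (Icc x (x + h)) := by
        rw [measureReal_def, gaussianReal_apply_eq_integral m hv, ENNReal.toReal_ofReal
          (integral_nonneg fun y => gaussianPDFReal_nonneg m v y)]
    _ ≤ (gaussianReal m v).real (Ici x) := measureReal_mono Icc_subset_Ici_self

lemma hasExpMoment_gaussianReal_one (v : ℝ≥0) : HasExpMoment (gaussianReal (-v / 2) v) 1 1 := by
  have hexponent : (1 : ℂ) * ((-v / 2 : ℝ) : ℂ) + v * 1 ^ 2 / 2 = 0 := by
    push_cast
    ring
  have hmoment := hasExpMoment_gaussianReal (-v / 2) v 1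
  rwa [hexponent, Complex.exp_zero] at hmoment

lemma add_sq_mul_gaussianPDFReal_le_putPrice {v : ℝ≥0} (hv : v ≠ 0) {a h : ℝ} (ha : a ≤ 0)
    (hh : 0 ≤ h) : 1 - Real.exp a + h ^ 2 * gaussianPDFReal (-v / 2) v (2 * h - a)
      ≤ putPrice (gaussianReal (-v / 2) v) a := by
  have htail := mul_gaussianPDFReal_le_gaussianReal_real_Ici (m := -v / 2) (x := h - a) hv
    (by linarith [v.coe_nonneg]) hh
  rw [sub_add_eq_add_sub, ← two_mul] at htail
  calc 1 - Real.exp a + h ^ 2 * gaussianPDFReal (-v / 2) v (2 * h - a)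
      ≤ 1 - Real.exp a + h * (gaussianReal (-v / 2) v).real (Ici (h - a)) := by
        rw [pow_two, mul_assoc]
        gcongr
    _ ≤ putPrice (gaussianReal (-v / 2) v) a :=
        add_mul_real_Ici_le_putPrice (hasExpMoment_gaussianReal_one v) h a

lemma tendsto_putPrice_of_tendsto_charFun {μs : ℕ → Measure ℝ} [∀ n, IsProbabilityMeasure (μs n)]
    [IsProbabilityMeasure μ]
    (h : ∀ u, Tendsto (fun n => charFun (μs n) u) atTop (𝓝 (charFun μ u))) (a : ℝ) :
    Tendsto (fun n => putPrice (μs n) a) atTop (𝓝 (putPrice μ a)) := by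
  have hweak := ProbabilityMeasure.tendsto_of_tendsto_charFun
    (μ := fun n => ⟨μs n, inferInstance⟩) (μ₀ := ⟨μ, inferInstance⟩) h
  exact ProbabilityMeasure.tendsto_iff_forall_integral_tendsto.1 hweak
    (BoundedContinuousFunction.ofNormedAddCommGroup (fun x => putPayoff (a + x)) (by fun_prop) 1
      fun _ => norm_putPayoff_le_one _)

end Put

section LevyMeasure

variable {ν : Measure ℝ}

lemma ae_exp_sub_one_nonneg (ν : Measure ℝ) :
    0 ≤ᵐ[ν.restrict (Ioi 0)] fun x => Real.exp x - 1 :=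
  (ae_restrict_mem measurableSet_Ioi).mono fun _ hx =>
    sub_nonneg.2 (Real.one_le_exp (mem_Ioi.1 hx).le)

lemma IsLevyMeasure.integrable_min (hν : IsLevyMeasure ν) :
    Integrable (fun x : ℝ => min 1 (x ^ 2)) ν := by
  refine ⟨by fun_prop, ?_⟩
  rw [hasFiniteIntegral_iff_ofReal (ae_of_all _ fun x => by positivity)]
  exact hν.lintegral_lt_top

lemma IsLevyMeasure.measure_lt_top (hν : IsLevyMeasure ν) {ε : ℝ} (hε : 0 < ε) {S : Set ℝ}
    (hS : ∀ x ∈ S, ε ≤ |x|) : ν S < ∞ := by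
  refine (measure_mono fun x hx => ?_).trans_lt
    (hν.integrable_min.measure_ge_lt_top (ε := min 1 (ε ^ 2)) (by positivity))
  rw [mem_ofPred_eq, ← sq_abs x]
  exact min_le_min_left _ (pow_le_pow_left₀ hε.le (hS x hx) 2)

lemma IsLevyMeasure.isFiniteMeasure_restrict_Iio (hν : IsLevyMeasure ν) {ε : ℝ} (hε : 0 < ε) :
    IsFiniteMeasure (ν.restrict (Iio (-ε))) :=
  isFiniteMeasure_restrict.2 (hν.measure_lt_top hε fun _ hx =>
    le_abs.2 (.inr (le_neg.2 (mem_Iio.1 hx).le))).ne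

lemma IsLevyMeasure.isFiniteMeasure_restrict_Ioi (hν : IsLevyMeasure ν) {ε : ℝ} (hε : 0 < ε) :
    IsFiniteMeasure (ν.restrict (Ioi ε)) :=
  isFiniteMeasure_restrict.2 (hν.measure_lt_top hε fun _ hx =>
    le_abs.2 (.inl (mem_Ioi.1 hx).le)).ne

lemma IsLevyMeasure.integrableOn_exp_Ioi (hν : IsLevyMeasure ν)
    (hexp : IntegrableOn Real.exp (Ioi 1) ν) {ε : ℝ} (hε : 0 < ε) :
    IntegrableOn Real.exp (Ioi ε) ν := by
  have hcompact : IntegrableOn Real.exp (Ioc ε 1) ν := by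
    refine Measure.integrableOn_of_bounded (M := Real.exp 1) ?_ (by fun_prop) ?_
    · exact (hν.measure_lt_top hε fun x hx => le_abs.2 (.inl hx.1.le)).ne
    · filter_upwards [ae_restrict_mem measurableSet_Ioc] with x hx
      simpa using hx.2
  exact (hcompact.union hexp).mono_set fun x hx => (le_or_gt x 1).imp (⟨hx, ·⟩) id

lemma IsLevyMeasure.tendsto_setIntegral_add_setIntegral (hν : IsLevyMeasure ν) {ε : ℕ → ℝ}
    (hε_nonneg : ∀ n, 0 ≤ ε n) (hε : Tendsto ε atTop (𝓝 0)) {f : ℝ → ℂ} (hf : Integrable f ν) :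
    Tendsto (fun n => (∫ x in Iio (-ε n), f x ∂ν) + ∫ x in Ioi (ε n), f x ∂ν) atTop
      (𝓝 (∫ x, f x ∂ν)) := by
  have hcover : AECover ν atTop fun n => Iio (-ε n) ∪ Ioi (ε n) := by
    refine ⟨?_, fun n => measurableSet_Iio.union measurableSet_Ioi⟩
    filter_upwards [compl_mem_ae_iff.2 hν.zero] with x hx
    filter_upwards [hε.eventually_lt_const (abs_pos.2 hx)] with n hn
    exact (lt_abs.1 hn).symm.imp (fun h => lt_neg.1 h) id
  have hsplit (n : ℕ) : ∫ x in Iio (-ε n) ∪ Ioi (ε n), f x ∂ν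
      = (∫ x in Iio (-ε n), f x ∂ν) + ∫ x in Ioi (ε n), f x ∂ν := by
    refine setIntegral_union ?_ measurableSet_Ioi hf.integrableOn hf.integrableOn
    exact Iio_disjoint_Ioi_iff.2 (by linarith [hε_nonneg n])
  simpa only [hsplit] using hcover.integral_tendsto_of_countably_generated hf

lemma min_one_sq_of_abs_le_one {x : ℝ} (hx : |x| ≤ 1) : min 1 (x ^ 2) = x ^ 2 :=
  min_eq_right ((sq_le_one_iff_abs_le_one x).2 hx)

lemma min_one_sq_of_one_lt_abs {x : ℝ} (hx : 1 < |x|) : min 1 (x ^ 2) = 1 :=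
  min_eq_left ((one_lt_sq_iff_one_lt_abs x).2 hx).le

lemma measurable_truncation : Measurable fun x : ℝ => if |x| ≤ 1 then x else 0 :=
  Measurable.ite (measurableSet_le (by fun_prop) (by fun_prop)) (by fun_prop) (by fun_prop)

lemma norm_exp_mul_I_sub_one_sub_le (x : ℝ) :
    ‖Complex.exp (Complex.I * x) - 1 - Complex.I * x‖ ≤ 3 * x ^ 2 := by
  have hx : ‖Complex.I * (x : ℂ)‖ = |x| := by simp
  rcases le_or_gt |x| 1 with hle | hgt
  · have hsmall := Complex.norm_exp_sub_one_sub_id_le (x := Complex.I * x) (by rwa [hx])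
    rw [hx, sq_abs] at hsmall
    linarith [sq_nonneg x]
  · have hlarge := norm_sub_le (Complex.exp (Complex.I * x) - 1) (Complex.I * x)
    rw [hx] at hlarge
    have hone : ‖Complex.exp (Complex.I * x) - 1‖ ≤ |x| := Real.norm_exp_I_mul_ofReal_sub_one_le
    rw [← sq_abs]
    nlinarith

lemma IsLevyMeasure.integrable_levyExponent_integrand (hν : IsLevyMeasure ν) (u : ℝ) :
    Integrable (fun x : ℝ => Complex.exp (Complex.I * u * x) - 1
      - Complex.I * u * ((if |x| ≤ 1 then x else 0 : ℝ) : ℂ)) ν := by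
  have htruncation := measurable_truncation
  refine (hν.integrable_min.const_mul (3 * u ^ 2 + 2)).mono' (by fun_prop)
    (ae_of_all _ fun x => ?_)
  have hmul : Complex.I * u * x = Complex.I * ((u * x : ℝ) : ℂ) := by push_cast; ring
  rw [hmul]
  split_ifs with hx
  · rw [min_one_sq_of_abs_le_one hx, mul_assoc, ← Complex.ofReal_mul]
    linarith [norm_exp_mul_I_sub_one_sub_le (u * x), mul_pow u x 2, sq_nonneg x]
  · rw [min_one_sq_of_one_lt_abs (not_le.1 hx)]
    have htriangle := norm_sub_le (Complex.exp (Complex.I * ((u * x : ℝ) : ℂ))) 1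
    rw [Complex.norm_exp_I_mul_ofReal, norm_one] at htriangle
    simp only [Complex.ofReal_zero, mul_zero, sub_zero]
    linarith [sq_nonneg u]

lemma IsLevyMeasure.integrable_exp_sub_one_sub (hν : IsLevyMeasure ν)
    (hexp : IntegrableOn Real.exp (Ioi 1) ν) :
    Integrable (fun x : ℝ => Real.exp x - 1 - (if |x| ≤ 1 then x else 0)) ν := by
  have htruncation := measurable_truncation
  refine (hν.integrable_min.add (hexp.integrable_indicator measurableSet_Ioi)).mono'
    (by fun_prop) (ae_of_all _ fun x => ?_)
  have hnonneg : 0 ≤ (Ioi 1).indicator Real.exp x := indicator_nonneg (fun _ _ => by positivity) x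
  rw [Pi.add_apply, Real.norm_eq_abs]
  split_ifs with hx
  · rw [min_one_sq_of_abs_le_one hx]
    linarith [Real.abs_exp_sub_one_sub_id_le hx]
  · rw [min_one_sq_of_one_lt_abs (not_le.1 hx), sub_zero]
    rcases lt_abs.1 (not_le.1 hx) with hgt | hlt
    · rw [indicator_of_mem (mem_Ioi.2 hgt), abs_of_nonneg (by linarith [Real.add_one_le_exp x])]
      linarith
    · rw [abs_of_nonpos (by linarith [Real.exp_le_one_iff.2 (by linarith : x ≤ 0)])]
      linarith [Real.exp_pos x]

lemma compensatedExp_mul_I (u x : ℝ) : compensatedExp (u * Complex.I) x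
    = (Complex.exp (Complex.I * u * x) - 1
        - Complex.I * u * ((if |x| ≤ 1 then x else 0 : ℝ) : ℂ))
      - Complex.I * u * ((Real.exp x - 1 - (if |x| ≤ 1 then x else 0) : ℝ) : ℂ) := by
  rw [compensatedExp, mul_comm (u : ℂ)]
  push_cast
  ring

lemma IsLevyMeasure.integrable_compensatedExp_mul_I (hν : IsLevyMeasure ν)
    (hexp : IntegrableOn Real.exp (Ioi 1) ν) (u : ℝ) :
    Integrable (compensatedExp (u * Complex.I)) ν := by
  rw [funext (compensatedExp_mul_I u)]
  exact (hν.integrable_levyExponent_integrand u).sub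
    ((hν.integrable_exp_sub_one_sub hexp).ofReal.const_mul _)

end LevyMeasure

section ExpMartingaleLaw

variable {ν κ μ : Measure ℝ} {v t : ℝ≥0}

/-- The cumulant exponent `ψ`, at complex order `z`, of the Lévy process with variance rate
`v` and Lévy measure `ν` whose drift is chosen so that `ψ(1) = 0`. -/
def expMartingaleExponent (v : ℝ≥0) (ν : Measure ℝ) (z : ℂ) : ℂ :=
  v / 2 * (z ^ 2 - z) + ∫ x, compensatedExp z x ∂ν

/-- The values of `expMartingaleExponent` at real orders. -/
def expMartingaleCumulant (v : ℝ≥0) (ν : Measure ℝ) (θ : ℝ) : ℝ :=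
  v / 2 * (θ ^ 2 - θ) + ∫ x, (Real.exp (θ * x) - 1 - θ * (Real.exp x - 1)) ∂ν

lemma expMartingaleExponent_ofReal (v : ℝ≥0) (ν : Measure ℝ) (θ : ℝ) :
    expMartingaleExponent v ν θ = expMartingaleCumulant v ν θ := by
  have hcast (x : ℝ) : compensatedExp θ x
      = ((Real.exp (θ * x) - 1 - θ * (Real.exp x - 1) : ℝ) : ℂ) := by
    simp [compensatedExp]
  simp only [expMartingaleExponent, expMartingaleCumulant, hcast, integral_complex_ofReal]
  push_cast
  rfl

lemma expMartingaleCumulant_one (v : ℝ≥0) (ν : Measure ℝ) : expMartingaleCumulant v ν 1 = 0 := by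
  simp [expMartingaleCumulant]

lemma levyExponent_eq_expMartingaleExponent {b : ℝ} (hν : IsLevyMeasure ν)
    (hexp : IntegrableOn Real.exp (Ioi 1) ν) (hmart : MartingaleCondition b v ν) (u : ℝ) :
    levyExponent b v ν u = expMartingaleExponent v ν (u * Complex.I) := by
  have hdrift : Integrable (fun x : ℝ =>
      Complex.I * u * ((Real.exp x - 1 - (if |x| ≤ 1 then x else 0) : ℝ) : ℂ)) ν :=
    (hν.integrable_exp_sub_one_sub hexp).ofReal.const_mul _
  simp only [expMartingaleExponent, compensatedExp_mul_I]
  rw [integral_sub (hν.integrable_levyExponent_integrand u) hdrift, integral_const_mul,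
    integral_complex_ofReal, levyExponent, hmart.drift, mul_pow, Complex.I_sq]
  push_cast
  ring

lemma MartingaleCondition.integrableOn_exp {b sigmaSq : ℝ}
    (hmart : MartingaleCondition b sigmaSq ν) : IntegrableOn Real.exp (Ioi 1) ν := by
  refine ⟨by fun_prop, ?_⟩
  rw [hasFiniteIntegral_iff_ofReal (ae_of_all _ fun x => (Real.exp_pos x).le)]
  exact hmart.exp_moment

/-- `μ` is the law at time `t` of the Lévy process with variance rate `v` and Lévy measure
`ν` whose exponential is a martingale; the drift is then determined by `v` and `ν`. -/
def IsExpMartingaleLaw (v : ℝ≥0) (ν : Measure ℝ) (t : ℝ≥0) (μ : Measure ℝ) : Prop :=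
  ∀ u : ℝ, charFun μ u = Complex.exp (t * expMartingaleExponent v ν (u * Complex.I))

/-- The law at time `t` of a Brownian motion with variance rate `v` plus an independent compound
Poisson process with finite jump intensity `κ`, both with drifts making their exponentials
martingales. -/
def jumpDiffusionLaw (v : ℝ≥0) (κ : Measure ℝ) (t : ℝ≥0) : Measure ℝ :=
  gaussianReal (-(v * t : ℝ≥0) / 2) (v * t) ∗ expCompensatedPoisson (t • κ)

/-- The approximation of an exponential martingale law obtained by deleting the jumps of size at
most `ε`, with the upward jumps as the last convolution factor. -/
def truncatedLaw (v : ℝ≥0) (ν : Measure ℝ) (t : ℝ≥0) (ε : ℝ) : Measure ℝ :=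
  jumpDiffusionLaw v (ν.restrict (Iio (-ε))) t ∗ expCompensatedPoisson (t • ν.restrict (Ioi ε))

instance isProbabilityMeasure_jumpDiffusionLaw [IsFiniteMeasure κ] :
    IsProbabilityMeasure (jumpDiffusionLaw v κ t) := by
  unfold jumpDiffusionLaw; infer_instance

lemma IsLevyMeasure.isProbabilityMeasure_truncatedLaw (hν : IsLevyMeasure ν) {ε : ℝ} (hε : 0 < ε) :
    IsProbabilityMeasure (truncatedLaw v ν t ε) := by
  have hdown := hν.isFiniteMeasure_restrict_Iio hε
  have hup := hν.isFiniteMeasure_restrict_Ioi hε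
  unfold truncatedLaw
  infer_instance

lemma hasExpMoment_jumpDiffusionLaw [IsFiniteMeasure κ] {z : ℂ}
    (hz : Integrable (fun x : ℝ => Complex.exp (z * x)) κ) (hexp : Integrable Real.exp κ) :
    HasExpMoment (jumpDiffusionLaw v κ t) z
      (Complex.exp (t * expMartingaleExponent v κ z)) := by
  have hexponent : (t : ℂ) * expMartingaleExponent v κ z
      = (z * ((-(v * t : ℝ≥0) / 2 : ℝ) : ℂ) + (v * t : ℝ≥0) * z ^ 2 / 2)
        + ∫ x, compensatedExp z x ∂(t • κ) := by
    rw [integral_smul_nnreal_measure, expMartingaleExponent, NNReal.smul_def, Complex.real_smul]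
    push_cast
    ring
  rw [hexponent, Complex.exp_add]
  exact (hasExpMoment_gaussianReal _ _ z).conv
    (hasExpMoment_expCompensatedPoisson hz.smul_measure_nnreal hexp.smul_measure_nnreal)

lemma integrable_exp_mul_I_mul [IsFiniteMeasure κ] (u : ℝ) :
    Integrable (fun x : ℝ => Complex.exp (u * Complex.I * x)) κ := by
  refine .of_bound (by fun_prop) 1 (ae_of_all _ fun x => ?_)
  simp [Complex.norm_exp]

lemma integrableOn_exp_mul_Iio {ε θ : ℝ} (hθ : 0 ≤ θ) (hε : 0 ≤ ε)
    [IsFiniteMeasure (ν.restrict (Iio (-ε)))] :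
    IntegrableOn (fun x => Real.exp (θ * x)) (Iio (-ε)) ν := by
  refine Integrable.of_bound (by fun_prop) 1 ?_
  filter_upwards [ae_restrict_mem measurableSet_Iio] with x hx
  rw [Real.norm_of_nonneg (Real.exp_pos _).le, Real.exp_le_one_iff]
  exact mul_nonpos_of_nonneg_of_nonpos hθ (by linarith [mem_Iio.1 hx])

lemma integrableOn_exp_Iio {ε : ℝ} (hε : 0 ≤ ε) [IsFiniteMeasure (ν.restrict (Iio (-ε)))] :
    IntegrableOn Real.exp (Iio (-ε)) ν := by
  simpa using integrableOn_exp_mul_Iio (ν := ν) zero_le_one hε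

lemma IsLevyMeasure.charFun_truncatedLaw (hν : IsLevyMeasure ν)
    (hexp : IntegrableOn Real.exp (Ioi 1) ν) {ε : ℝ} (hε : 0 < ε) (u : ℝ) :
    charFun (truncatedLaw v ν t ε) u =
      Complex.exp (t * (v / 2 * ((u * Complex.I) ^ 2 - u * Complex.I)
        + ((∫ x in Iio (-ε), compensatedExp (u * Complex.I) x ∂ν)
          + ∫ x in Ioi ε, compensatedExp (u * Complex.I) x ∂ν))) := by
  have hdown := hν.isFiniteMeasure_restrict_Iio hε
  have hup := hν.isFiniteMeasure_restrict_Ioi hε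
  have hexp_down := integrableOn_exp_Iio (ν := ν) hε.le
  have hexp_up := hν.integrableOn_exp_Ioi hexp hε
  have hmoment := (hasExpMoment_jumpDiffusionLaw (v := v) (t := t)
    (integrable_exp_mul_I_mul u) hexp_down).conv
    (hasExpMoment_expCompensatedPoisson (κ := t • ν.restrict (Ioi ε)) (integrable_exp_mul_I_mul u)
      hexp_up.smul_measure_nnreal)
  rw [truncatedLaw, hmoment.charFun_eq, ← Complex.exp_add, integral_smul_nnreal_measure,
    expMartingaleExponent, NNReal.smul_def, Complex.real_smul, ← mul_add, add_assoc]

lemma tendsto_putPrice_truncatedLaw [IsProbabilityMeasure μ] (hμ : IsExpMartingaleLaw v ν t μ)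
    (hν : IsLevyMeasure ν) (hexp : IntegrableOn Real.exp (Ioi 1) ν) {ε : ℕ → ℝ}
    (hε_pos : ∀ n, 0 < ε n) (hε : Tendsto ε atTop (𝓝 0)) (a : ℝ) :
    Tendsto (fun n => putPrice (truncatedLaw v ν t (ε n)) a) atTop (𝓝 (putPrice μ a)) := by
  have hprob (n : ℕ) := hν.isProbabilityMeasure_truncatedLaw (v := v) (t := t) (hε_pos n)
  refine tendsto_putPrice_of_tendsto_charFun (fun u => ?_) a
  simp only [hμ u, fun n => hν.charFun_truncatedLaw (v := v) (t := t) hexp (hε_pos n) u]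
  refine (Complex.continuous_exp.tendsto _).comp (Tendsto.const_mul _ (Tendsto.const_add _ ?_))
  exact hν.tendsto_setIntegral_add_setIntegral (fun n => (hε_pos n).le) hε
    (hν.integrable_compensatedExp_mul_I hexp u)

lemma putPrice_gaussianReal_le_jumpDiffusionLaw [IsFiniteMeasure κ] (hexp : Integrable Real.exp κ)
    (a : ℝ) :
    putPrice (gaussianReal (-(v * t : ℝ≥0) / 2) (v * t)) a ≤ putPrice (jumpDiffusionLaw v κ t) a :=
  putPrice_le_putPrice_conv (hasExpMoment_expCompensatedPoisson_one hexp.smul_measure_nnreal) a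

lemma IsExpMartingaleLaw.putPrice_gaussianReal_le [IsProbabilityMeasure μ]
    (hμ : IsExpMartingaleLaw v ν t μ) (hν : IsLevyMeasure ν)
    (hexp : IntegrableOn Real.exp (Ioi 1) ν) (a : ℝ) :
    putPrice (gaussianReal (-(v * t : ℝ≥0) / 2) (v * t)) a ≤ putPrice μ a := by
  have hε_pos (n : ℕ) : (0 : ℝ) < 1 / (n + 1) := Nat.one_div_pos_of_nat
  refine ge_of_tendsto' (tendsto_putPrice_truncatedLaw hμ hν hexp hε_pos
    tendsto_one_div_add_atTop_nhds_zero_nat a) fun n => ?_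
  have hdown := hν.isFiniteMeasure_restrict_Iio (hε_pos n)
  have hup := hν.isFiniteMeasure_restrict_Ioi (hε_pos n)
  have hexp_down := integrableOn_exp_Iio (ν := ν) ((hε_pos n).le)
  have hexp_up := hν.integrableOn_exp_Ioi hexp (hε_pos n)
  calc putPrice (gaussianReal (-(v * t : ℝ≥0) / 2) (v * t)) a
      ≤ putPrice (jumpDiffusionLaw v (ν.restrict (Iio (-(1 / (n + 1 : ℝ))))) t) a :=
        putPrice_gaussianReal_le_jumpDiffusionLaw hexp_down a
    _ ≤ putPrice (truncatedLaw v ν t (1 / (n + 1))) a :=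
        putPrice_le_putPrice_conv
          (hasExpMoment_expCompensatedPoisson_one hexp_up.smul_measure_nnreal) a

lemma exp_le_one_add_add_sq_div_two {y : ℝ} (hy : y ≤ 0) : Real.exp y ≤ 1 + y + y ^ 2 / 2 := by
  have hquad := Real.quadratic_le_exp_of_nonneg (neg_nonneg.2 hy)
  have hpos : 0 < 1 + y + y ^ 2 / 2 := by nlinarith [sq_nonneg (y + 1)]
  calc Real.exp y = Real.exp y * 1 := (mul_one _).symm
    _ ≤ Real.exp y * ((1 + y + y ^ 2 / 2) * (1 + -y + (-y) ^ 2 / 2)) := by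
        gcongr
        nlinarith [sq_nonneg (y ^ 2)]
    _ ≤ Real.exp y * ((1 + y + y ^ 2 / 2) * Real.exp (-y)) := by gcongr
    _ = 1 + y + y ^ 2 / 2 := by
        rw [mul_left_comm, ← Real.exp_add, add_neg_cancel, Real.exp_zero, mul_one]

lemma exp_mul_sub_one_sub_nonneg {θ : ℝ} (hθ : 1 ≤ θ) (x : ℝ) :
    0 ≤ Real.exp (θ * x) - 1 - θ * (Real.exp x - 1) := by
  linarith [one_add_mul_exp_sub_one_le_exp_mul hθ x]

lemma exp_mul_sub_one_sub_le_self {θ x : ℝ} (hθ : 0 ≤ θ) (hx : x ≤ 0) :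
    Real.exp (θ * x) - 1 - θ * (Real.exp x - 1) ≤ θ := by
  have hle_one : Real.exp (θ * x) ≤ 1 :=
    Real.exp_le_one_iff.2 (mul_nonpos_of_nonneg_of_nonpos hθ hx)
  nlinarith [mul_nonneg hθ (Real.exp_pos x).le]

lemma exp_mul_sub_one_sub_le_sq_mul_min {θ x : ℝ} (hθ : 1 ≤ θ) (hx : x ≤ 0) :
    Real.exp (θ * x) - 1 - θ * (Real.exp x - 1) ≤ θ ^ 2 * min 1 (x ^ 2) := by
  have hθ0 : 0 ≤ θ := by linarith
  rw [mul_min_of_nonneg _ _ (sq_nonneg θ), mul_one]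
  refine le_min ((exp_mul_sub_one_sub_le_self hθ0 hx).trans (by nlinarith)) ?_
  have hquad := exp_le_one_add_add_sq_div_two (mul_nonpos_of_nonneg_of_nonpos hθ0 hx)
  have hlin := mul_le_mul_of_nonneg_left (Real.add_one_le_exp x) hθ0
  nlinarith [sq_nonneg (θ * x)]

lemma IsLevyMeasure.integrableOn_exp_mul_sub_one_sub (hν : IsLevyMeasure ν) {θ : ℝ} (hθ : 1 ≤ θ) :
    IntegrableOn (fun x => Real.exp (θ * x) - 1 - θ * (Real.exp x - 1)) (Iio 0) ν := by
  refine (hν.integrable_min.const_mul (θ ^ 2)).integrableOn.mono' (by fun_prop) ?_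
  filter_upwards [ae_restrict_mem measurableSet_Iio] with x hx
  rw [Real.norm_of_nonneg (exp_mul_sub_one_sub_nonneg hθ x)]
  exact exp_mul_sub_one_sub_le_sq_mul_min hθ (mem_Iio.1 hx).le

lemma IsLevyMeasure.expMartingaleCumulant_restrict_Iio_le (hν : IsLevyMeasure ν) {θ ε : ℝ}
    (hθ : 1 ≤ θ) (hε : 0 ≤ ε) : expMartingaleCumulant v (ν.restrict (Iio (-ε))) θ
      ≤ expMartingaleCumulant v (ν.restrict (Iio 0)) θ :=
  add_le_add_right (setIntegral_mono_set (hν.integrableOn_exp_mul_sub_one_sub hθ)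
    (ae_of_all _ fun x => exp_mul_sub_one_sub_nonneg hθ x)
    (Iio_subset_Iio (neg_nonpos.2 hε)).eventuallyLE) _

lemma IsLevyMeasure.tendsto_expMartingaleCumulant_div_sq (hν : IsLevyMeasure ν) (v : ℝ≥0) :
    Tendsto (fun θ => expMartingaleCumulant v (ν.restrict (Iio 0)) θ / θ ^ 2) atTop
      (𝓝 (v / 2)) := by
  have hinv : Tendsto (fun θ : ℝ => θ⁻¹) atTop (𝓝 0) := tendsto_inv_atTop_zero
  have hgauss : Tendsto (fun θ : ℝ => (v : ℝ) / 2 * (1 - θ⁻¹)) atTop (𝓝 (v / 2)) := by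
    simpa using (hinv.const_sub 1).const_mul ((v : ℝ) / 2)
  have hjump : Tendsto (fun θ => ∫ x in Iio 0,
      (Real.exp (θ * x) - 1 - θ * (Real.exp x - 1)) / θ ^ 2 ∂ν) atTop (𝓝 0) := by
    rw [show 𝓝 (0 : ℝ) = 𝓝 (∫ _ in Iio (0 : ℝ), 0 ∂ν) by rw [integral_zero]]
    refine tendsto_integral_filter_of_dominated_convergence (fun x => min 1 (x ^ 2))
      (.of_forall fun θ => by fun_prop) ?_ hν.integrable_min.integrableOn ?_
    · filter_upwards [eventually_ge_atTop 1] with θ hθ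
      filter_upwards [ae_restrict_mem measurableSet_Iio] with x hx
      rw [Real.norm_of_nonneg (div_nonneg (exp_mul_sub_one_sub_nonneg hθ x) (sq_nonneg θ)),
        div_le_iff₀' (by positivity)]
      exact exp_mul_sub_one_sub_le_sq_mul_min hθ (mem_Iio.1 hx).le
    · filter_upwards [ae_restrict_mem measurableSet_Iio] with x hx
      refine squeeze_zero' ?_ ?_ hinv
      · filter_upwards [eventually_ge_atTop 1] with θ hθ
        exact div_nonneg (exp_mul_sub_one_sub_nonneg hθ x) (sq_nonneg θ)
      · filter_upwards [eventually_ge_atTop 1] with θ hθ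
        rw [div_le_iff₀ (by positivity), sq, inv_mul_cancel_left₀ (by positivity)]
        exact exp_mul_sub_one_sub_le_self (by positivity) (mem_Iio.1 hx).le
  refine (add_zero ((v : ℝ) / 2) ▸ hgauss.add hjump).congr' ?_
  filter_upwards [eventually_gt_atTop 0] with θ hθ
  rw [integral_div, expMartingaleCumulant]
  field_simp

lemma hasExpMoment_jumpDiffusionLaw_ofReal [IsFiniteMeasure κ] {θ : ℝ}
    (hθ : Integrable (fun x => Real.exp (θ * x)) κ) (hexp : Integrable Real.exp κ) :
    HasExpMoment (jumpDiffusionLaw v κ t) θ (Real.exp (t * expMartingaleCumulant v κ θ) : ℝ) := by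
  have hz : Integrable (fun x : ℝ => Complex.exp (θ * x)) κ :=
    (hθ.ofReal (𝕜 := ℂ)).congr (ae_of_all _ fun x => by simp)
  have hmoment := hasExpMoment_jumpDiffusionLaw (v := v) (t := t) hz hexp
  rw [expMartingaleExponent_ofReal] at hmoment
  exact_mod_cast hmoment

lemma hasExpMoment_jumpDiffusionLaw_one [IsFiniteMeasure κ] (hexp : Integrable Real.exp κ) :
    HasExpMoment (jumpDiffusionLaw v κ t) 1 1 := by
  simpa [expMartingaleCumulant_one] using
    hasExpMoment_jumpDiffusionLaw_ofReal (v := v) (t := t) (θ := 1) (by simpa using hexp) hexp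

lemma IsLevyMeasure.putPrice_truncatedLaw_le (hν : IsLevyMeasure ν)
    (hup : IntegrableOn (fun x => Real.exp x - 1) (Ioi 0) ν) {ε θ : ℝ} (hε : 0 < ε) (hθ : 1 ≤ θ)
    (a : ℝ) :
    putPrice (truncatedLaw v ν t ε) (a + t * ∫ x in Ioi 0, (Real.exp x - 1) ∂ν) ≤
      1 - Real.exp a
        + Real.exp (θ * a) * Real.exp (t * expMartingaleCumulant v (ν.restrict (Iio 0)) θ) / θ := by
  have hfin_down := hν.isFiniteMeasure_restrict_Iio hε
  have hfin_up := hν.isFiniteMeasure_restrict_Ioi hε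
  have hθ0 : 0 ≤ θ := by linarith
  have hexp_down := integrableOn_exp_Iio (ν := ν) hε.le
  have hup_nonneg : ∀ᵐ x ∂(t • ν.restrict (Ioi ε)), 0 ≤ x :=
    Measure.ae_smul_measure ((ae_restrict_mem measurableSet_Ioi).mono fun x hx =>
      hε.le.trans (mem_Ioi.1 hx).le) t
  have hcompensator :
      ∫ x, (Real.exp x - 1) ∂(t • ν.restrict (Ioi ε)) ≤ t * ∫ x in Ioi 0, (Real.exp x - 1) ∂ν := by
    rw [integral_smul_nnreal_measure, NNReal.smul_def, smul_eq_mul]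
    gcongr
    exact ae_exp_sub_one_nonneg ν
  calc putPrice (truncatedLaw v ν t ε) (a + t * ∫ x in Ioi 0, (Real.exp x - 1) ∂ν)
      ≤ putPrice (jumpDiffusionLaw v (ν.restrict (Iio (-ε))) t)
          (a + t * (∫ x in Ioi 0, (Real.exp x - 1) ∂ν)
            - ∫ x, (Real.exp x - 1) ∂(t • ν.restrict (Ioi ε))) :=
        putPrice_conv_expCompensatedPoisson_le hup_nonneg _
    _ ≤ putPrice (jumpDiffusionLaw v (ν.restrict (Iio (-ε))) t) a :=
        antitone_putPrice (by linarith)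
    _ ≤ 1 - Real.exp a + Real.exp (θ * a)
          * Real.exp (t * expMartingaleCumulant v (ν.restrict (Iio (-ε))) θ) / θ :=
        putPrice_le_of_hasExpMoment (hasExpMoment_jumpDiffusionLaw_one hexp_down) hθ
          (hasExpMoment_jumpDiffusionLaw_ofReal (integrableOn_exp_mul_Iio hθ0 hε.le) hexp_down) a
    _ ≤ _ := by
        gcongr
        exact hν.expMartingaleCumulant_restrict_Iio_le hθ hε.le

lemma IsExpMartingaleLaw.putPrice_le [IsProbabilityMeasure μ] (hμ : IsExpMartingaleLaw v ν t μ)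
    (hν : IsLevyMeasure ν) (hexp : IntegrableOn Real.exp (Ioi 1) ν)
    (hup : IntegrableOn (fun x => Real.exp x - 1) (Ioi 0) ν) {θ : ℝ} (hθ : 1 ≤ θ) (a : ℝ) :
    putPrice μ (a + t * ∫ x in Ioi 0, (Real.exp x - 1) ∂ν) ≤
      1 - Real.exp a
        + Real.exp (θ * a) * Real.exp (t * expMartingaleCumulant v (ν.restrict (Iio 0)) θ) / θ := by
  have hε_pos (n : ℕ) : (0 : ℝ) < 1 / (n + 1) := Nat.one_div_pos_of_nat
  exact le_of_tendsto' (tendsto_putPrice_truncatedLaw hμ hν hexp hε_pos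
    tendsto_one_div_add_atTop_nhds_zero_nat _) fun n =>
    hν.putPrice_truncatedLaw_le hup (hε_pos n) hθ a

end ExpMartingaleLaw

section SmallTime

variable {τ : ℝ}

/-- The order of magnitude of the distance in log-price between the strike and the critical price a
time `τ` before maturity. -/
def logScale (τ : ℝ) : ℝ := √(-(τ * Real.log τ))

lemma logScale_nonneg (τ : ℝ) : 0 ≤ logScale τ := Real.sqrt_nonneg _

lemma logScale_sq (hτ : 0 ≤ τ) (hτ_one : τ ≤ 1) : logScale τ ^ 2 = τ * -Real.log τ := by
  rw [logScale, Real.sq_sqrt] <;> nlinarith [Real.log_nonpos hτ hτ_one]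

lemma sqrt_le_logScale (hτ : 0 ≤ τ) (hlog : Real.log τ ≤ -1) : √τ ≤ logScale τ :=
  Real.sqrt_le_sqrt (by nlinarith)

lemma tendsto_logScale : Tendsto logScale (𝓝[>] 0) (𝓝 0) := by
  have hcont : Continuous logScale := Real.continuous_sqrt.comp Real.continuous_mul_log.neg
  simpa [logScale] using (hcont.tendsto 0).mono_left nhdsWithin_le_nhds

lemma eventually_logScale_pos : ∀ᶠ τ in 𝓝[>] 0, 0 < logScale τ := by
  filter_upwards [Ioo_mem_nhdsGT zero_lt_one] with τ hτ
  exact Real.sqrt_pos.2 (neg_pos.2 (mul_neg_of_pos_of_neg hτ.1 (Real.log_neg hτ.1 hτ.2)))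

lemma eventually_log_le (c : ℝ) : ∀ᶠ τ in 𝓝[>] 0, Real.log τ ≤ c :=
  Real.tendsto_log_nhdsGT_zero.eventually_le_atBot c

lemma tendsto_rpow_div_logScale {p : ℝ} (hp : 1 / 2 < p) :
    Tendsto (fun τ => τ ^ p / logScale τ) (𝓝[>] 0) (𝓝 0) := by
  have hpow : Tendsto (fun τ : ℝ => τ ^ (p - 1 / 2)) (𝓝[>] 0) (𝓝 0) := by
    have hp' : 0 < p - 1 / 2 := by linarith
    have hcont := (Real.continuousAt_rpow_const 0 _ (.inr hp'.le)).tendsto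
    rw [Real.zero_rpow hp'.ne'] at hcont
    exact hcont.mono_left nhdsWithin_le_nhds
  refine squeeze_zero' ?_ ?_ hpow
  · filter_upwards [self_mem_nhdsWithin] with τ hτ
    exact div_nonneg (Real.rpow_nonneg (mem_Ioi.1 hτ).le _) (logScale_nonneg τ)
  · filter_upwards [self_mem_nhdsWithin, eventually_log_le (-1), eventually_logScale_pos]
      with τ hτ hlog hpos
    have hτ0 : 0 < τ := hτ
    rw [div_le_iff₀ hpos]
    calc τ ^ p = τ ^ (p - 1 / 2) * √τ := by
          rw [Real.sqrt_eq_rpow, ← Real.rpow_add hτ0, sub_add_cancel]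
      _ ≤ τ ^ (p - 1 / 2) * logScale τ := by gcongr; exact sqrt_le_logScale hτ0.le hlog

lemma tendsto_div_logScale : Tendsto (fun τ => τ / logScale τ) (𝓝[>] 0) (𝓝 0) := by
  simpa using tendsto_rpow_div_logScale (p := 1) (by norm_num)

lemma tendsto_logScale_div : Tendsto (fun τ => logScale τ / τ) (𝓝[>] 0) atTop := by
  have hpos : ∀ᶠ τ in 𝓝[>] 0, τ / logScale τ ∈ Ioi (0 : ℝ) := by
    filter_upwards [self_mem_nhdsWithin, eventually_logScale_pos] with τ hτ hpos
    exact div_pos hτ hpos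
  refine (tendsto_nhdsWithin_iff.2
    ⟨tendsto_div_logScale, hpos⟩).inv_tendsto_nhdsGT_zero.congr fun τ => ?_
  rw [Pi.inv_apply, inv_div]

lemma eventually_mul_le_mul_logScale (C : ℝ) {ε : ℝ} (hε : 0 < ε) :
    ∀ᶠ τ in 𝓝[>] 0, C * τ ≤ ε * logScale τ := by
  have hlim : Tendsto (fun τ => C * (τ / logScale τ)) (𝓝[>] 0) (𝓝 0) := by
    simpa using tendsto_div_logScale.const_mul C
  filter_upwards [hlim.eventually_le_const hε, eventually_logScale_pos] with τ hle hpos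
  rwa [← mul_div_assoc, div_le_iff₀ hpos] at hle

lemma tendsto_exp_mul_sub_one_div (a : ℝ) :
    Tendsto (fun y : ℝ => (Real.exp (a * y) - 1) / y) (𝓝[>] 0) (𝓝 a) := by
  have hderiv : HasDerivAt (fun y : ℝ => Real.exp (a * y)) a 0 := by
    simpa using ((hasDerivAt_id (0 : ℝ)).const_mul a).exp
  simpa [div_eq_inv_mul] using hderiv.tendsto_slope_zero_right

lemma eventually_exp_mul_sub_one_le {a C : ℝ} (haC : a < C) :
    ∀ᶠ τ in 𝓝[>] 0, Real.exp (a * τ) - 1 ≤ C * τ := by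
  filter_upwards [(tendsto_exp_mul_sub_one_div a).eventually_le_const haC, self_mem_nhdsWithin]
    with τ hle hτ
  rwa [div_le_iff₀ hτ] at hle

lemma exp_mul_exp_le_rpow_mul_exp {a v g y q : ℝ} (hv : 0 < v) (hτ : 0 < τ)
    (hy : y ^ 2 = τ * -Real.log τ) (hq : q ≤ v / 2 * (a / v * (y / τ)) ^ 2) :
    Real.exp (a / v * (y / τ) * (-(a * y) + g * τ)) * Real.exp (τ * q)
      ≤ τ ^ (a ^ 2 / (2 * v)) * Real.exp (g * (a / v) * y) := by
  rw [Real.rpow_def_of_pos hτ, ← Real.exp_add, ← Real.exp_add, Real.exp_le_exp]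
  calc a / v * (y / τ) * (-(a * y) + g * τ) + τ * q
      ≤ a / v * (y / τ) * (-(a * y) + g * τ) + τ * (v / 2 * (a / v * (y / τ)) ^ 2) := by gcongr
    _ = -(a ^ 2 / (2 * v)) * (y ^ 2 / τ) + g * (a / v) * y := by
        field_simp
        ring
    _ = Real.log τ * (a ^ 2 / (2 * v)) + g * (a / v) * y := by
        rw [hy, mul_div_cancel_left₀ _ hτ.ne']
        ring

lemma eventually_chernoff_le {ψ : ℝ → ℝ} {a v g : ℝ}
    (hψ : Tendsto (fun θ => ψ θ / θ ^ 2) atTop (𝓝 (v / 2))) (hv : 0 ≤ v) (ha : 0 < a)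
    (hav : v < a ^ 2) (hg : 0 < g) :
    ∀ᶠ τ in 𝓝[>] 0, ∃ θ, 1 ≤ θ ∧
      Real.exp (θ * (-(a * logScale τ) + g * τ)) * Real.exp (τ * ψ θ) / θ
        ≤ Real.exp (-(a * logScale τ)) * (g * τ) := by
  obtain ⟨v', hvv', hv'a⟩ := exists_between hav
  have hv' : 0 < v' := hv.trans_lt hvv'
  set c := a / v'
  have hc0 : 0 < c := div_pos ha hv'
  set p := a ^ 2 / (2 * v') with hp
  have hp_half : 1 / 2 < p := by rw [hp, div_lt_div_iff₀ two_pos (by positivity)]; linarith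
  have hlim : Tendsto (fun τ => τ ^ p / logScale τ * (Real.exp ((g * c + a) * logScale τ) / c))
      (𝓝[>] 0) (𝓝 0) := by
    simpa using (tendsto_rpow_div_logScale hp_half).mul
      ((tendsto_logScale.const_mul (g * c + a)).rexp.div_const c)
  -- `θ = c y / τ` minimises the leading part `- θ a y + τ v' θ² / 2` of the exponent.
  have hθ : Tendsto (fun τ => c * (logScale τ / τ)) (𝓝[>] 0) atTop :=
    tendsto_logScale_div.const_mul_atTop hc0
  filter_upwards [hlim.eventually_le_const hg, hθ.eventually_ge_atTop 1,
    hθ.eventually (hψ.eventually_le_const (show v / 2 < v' / 2 by linarith)),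
    Ioo_mem_nhdsGT zero_lt_one, eventually_logScale_pos] with τ hsmall hθ_one hcumulant hτ hy
  have hτ0 : 0 < τ := hτ.1
  refine ⟨c * (logScale τ / τ), hθ_one, ?_⟩
  have hy_sq := logScale_sq hτ0.le hτ.2.le
  rw [div_le_iff₀ (by positivity)] at hcumulant
  have hexp : Real.exp ((g * c + a) * logScale τ)
      = Real.exp (g * c * logScale τ) * Real.exp (a * logScale τ) := by
    rw [← Real.exp_add, add_mul]
  calc _ ≤ τ ^ p * Real.exp (g * c * logScale τ) / (c * (logScale τ / τ)) := by
        refine div_le_div_of_nonneg_right ?_ (by positivity)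
        exact exp_mul_exp_le_rpow_mul_exp hv' hτ0 hy_sq hcumulant
    _ = Real.exp (-(a * logScale τ))
          * (τ ^ p / logScale τ * (Real.exp ((g * c + a) * logScale τ) / c) * τ) := by
        rw [hexp, Real.exp_neg]
        field_simp
    _ ≤ Real.exp (-(a * logScale τ)) * (g * τ) := by gcongr

lemma rpow_mul_le_gaussianPDFReal {v : ℝ≥0} {a m x y : ℝ} (hτ : 0 < τ)
    (hy : y ^ 2 = τ * -Real.log τ) (hx : |x - m| ≤ a * y) :
    (√(2 * Real.pi * v))⁻¹ * τ ^ (a ^ 2 / (2 * v) - 1 / 2)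
      ≤ gaussianPDFReal m (v * τ.toNNReal) x := by
  have hexponent : Real.log τ * (a ^ 2 / (2 * v)) ≤ -(x - m) ^ 2 / (2 * (v * τ)) := by
    calc Real.log τ * (a ^ 2 / (2 * v)) = -(a * y) ^ 2 / (2 * (v * τ)) := by
          rw [mul_pow, hy]
          field_simp
      _ ≤ -(x - m) ^ 2 / (2 * (v * τ)) := by
          have hsq := sq_le_sq' (neg_le_of_abs_le hx) (le_of_abs_le hx)
          gcongr
  calc (√(2 * Real.pi * v))⁻¹ * τ ^ (a ^ 2 / (2 * v) - 1 / 2)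
      = (√(2 * Real.pi * (v * τ)))⁻¹ * Real.exp (Real.log τ * (a ^ 2 / (2 * v))) := by
        rw [← mul_assoc (2 * Real.pi), Real.sqrt_mul (by positivity) τ, Real.rpow_sub hτ,
          ← Real.sqrt_eq_rpow, Real.rpow_def_of_pos hτ, mul_inv]
        ring
    _ ≤ (√(2 * Real.pi * (v * τ)))⁻¹ * Real.exp (-(x - m) ^ 2 / (2 * (v * τ))) := by gcongr
    _ = gaussianPDFReal m (v * τ.toNNReal) x := by
        rw [gaussianPDFReal, NNReal.coe_mul, Real.coe_toNNReal _ hτ.le]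

lemma eventually_mul_lt_sq_mul_gaussianPDFReal {v : ℝ≥0} {a ε : ℝ} (C : ℝ) (hav : a ^ 2 < v)
    (hε : 0 < ε) :
    ∀ᶠ τ in 𝓝[>] 0, ∀ m x : ℝ, |x - m| ≤ a * logScale τ →
      C * τ < (ε * logScale τ) ^ 2 * gaussianPDFReal m (v * τ.toNNReal) x := by
  have hv : (0 : ℝ) < v := (sq_nonneg a).trans_lt hav
  set p := a ^ 2 / (2 * v) with hp
  have hp_half : p < 1 / 2 := by rw [hp, div_lt_div_iff₀ (by positivity) two_pos]; linarith
  have hlim : Tendsto (fun τ : ℝ => ε ^ 2 * (√(2 * Real.pi * v))⁻¹ * τ ^ (p - 1 / 2))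
      (𝓝[>] 0) atTop :=
    (tendsto_rpow_neg_nhdsGT_zero (by linarith)).const_mul_atTop (by positivity)
  filter_upwards [hlim.eventually_gt_atTop C, Ioo_mem_nhdsGT zero_lt_one, eventually_log_le (-1)]
    with τ hlarge hτ hlog m x hx
  have hτ0 : 0 < τ := hτ.1
  have hy := logScale_sq hτ0.le hτ.2.le
  calc C * τ < ε ^ 2 * (√(2 * Real.pi * v))⁻¹ * τ ^ (p - 1 / 2) * τ := by gcongr
    _ ≤ ε ^ 2 * (√(2 * Real.pi * v))⁻¹ * τ ^ (p - 1 / 2) * (τ * -Real.log τ) := by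
        gcongr
        nlinarith
    _ = (ε * logScale τ) ^ 2 * ((√(2 * Real.pi * v))⁻¹ * τ ^ (p - 1 / 2)) := by
        rw [mul_pow, hy]
        ring
    _ ≤ (ε * logScale τ) ^ 2 * gaussianPDFReal m (v * τ.toNNReal) x := by
        gcongr
        exact rpow_mul_le_gaussianPDFReal hτ0 hy hx

variable {μ : ℝ≥0 → Measure ℝ} [∀ t, IsProbabilityMeasure (μ t)] {ν : Measure ℝ} {v : ℝ≥0}
  {a : ℝ}

lemma eventually_putPrice_le (hμ : ∀ t, IsExpMartingaleLaw v ν t (μ t)) (hν : IsLevyMeasure ν)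
    (hexp : IntegrableOn Real.exp (Ioi 1) ν)
    (hup : IntegrableOn (fun x => Real.exp x - 1) (Ioi 0) ν)
    {β : ℝ} (hβ : ∫ x in Ioi 0, (Real.exp x - 1) ∂ν < β) (ha : 0 < a) (hav : v < a ^ 2) :
    ∀ᶠ τ in 𝓝[>] 0, putPrice (μ τ.toNNReal) (-(a * logScale τ) + β * τ)
      ≤ 1 - Real.exp (-(a * logScale τ)) := by
  set J := ∫ x in Ioi 0, (Real.exp x - 1) ∂ν
  filter_upwards [eventually_chernoff_le (hν.tendsto_expMartingaleCumulant_div_sq v) v.coe_nonneg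
    ha hav (sub_pos.2 hβ), self_mem_nhdsWithin] with τ ⟨θ, hθ, hchernoff⟩ hτ
  have hput := (hμ τ.toNNReal).putPrice_le hν hexp hup hθ (-(a * logScale τ) + (β - J) * τ)
  rw [Real.coe_toNNReal _ (mem_Ioi.1 hτ).le,
    show -(a * logScale τ) + (β - J) * τ + τ * J = -(a * logScale τ) + β * τ by ring] at hput
  have hgain : Real.exp (-(a * logScale τ)) + Real.exp (-(a * logScale τ)) * ((β - J) * τ)
      ≤ Real.exp (-(a * logScale τ) + (β - J) * τ) := by
    rw [Real.exp_add, ← mul_one_add]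
    gcongr
    linarith [Real.add_one_le_exp ((β - J) * τ)]
  linarith

lemma eventually_add_mul_lt_putPrice_gaussianReal (ha : 0 < a) (hav : a ^ 2 < v) (β C : ℝ) :
    ∀ᶠ τ in 𝓝[>] 0, 1 - Real.exp (-(a * logScale τ) + β * τ) + C * τ
      < putPrice (gaussianReal (-(v * τ.toNNReal : ℝ≥0) / 2) (v * τ.toNNReal))
          (-(a * logScale τ) + β * τ) := by
  have hv : 0 < v := NNReal.coe_pos.1 ((sq_nonneg a).trans_lt hav)
  obtain ⟨a', haa', ha'v⟩ := exists_between (Real.lt_sqrt_of_sq_lt hav)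
  have ha'_sq : a' ^ 2 < v := (Real.lt_sqrt (ha.le.trans haa'.le)).1 ha'v
  obtain ⟨ε, hε, hεa'⟩ : ∃ ε > 0, a + 3 * ε = a' := ⟨(a' - a) / 3, by linarith, by ring⟩
  filter_upwards [self_mem_nhdsWithin, eventually_mul_le_mul_logScale β ha,
    eventually_mul_le_mul_logScale |v / 2 - β| hε,
    eventually_mul_lt_sq_mul_gaussianPDFReal C ha'_sq hε] with τ hτ hβ hdrift hdensity
  have hτ0 : 0 < τ := hτ
  have hy := logScale_nonneg τ
  have hdist : |2 * (ε * logScale τ) - (-(a * logScale τ) + β * τ)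
      - -(v * τ.toNNReal : ℝ≥0) / 2| ≤ a' * logScale τ := by
    rw [NNReal.coe_mul, Real.coe_toNNReal _ hτ0.le]
    calc _ = |(a + 2 * ε) * logScale τ + (v / 2 - β) * τ| := by ring_nf
      _ ≤ (a + 2 * ε) * logScale τ + |v / 2 - β| * τ := by
          refine (abs_add_le _ _).trans_eq ?_
          rw [abs_of_nonneg (by positivity), abs_mul, abs_of_pos hτ0]
      _ ≤ a' * logScale τ := by
          rw [← hεa']
          linarith
  have htail := add_sq_mul_gaussianPDFReal_le_putPrice
    (mul_pos hv (Real.toNNReal_pos.2 hτ0)).ne' (by linarith : -(a * logScale τ) + β * τ ≤ 0)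
    (by positivity : 0 ≤ ε * logScale τ)
  linarith [hdensity _ _ hdist]

lemma eventually_lt_putPrice (hμ : ∀ t, IsExpMartingaleLaw v ν t (μ t)) (hν : IsLevyMeasure ν)
    (hexp : IntegrableOn Real.exp (Ioi 1) ν) (ha : 0 < a) (hav : a ^ 2 < v) (ρ β : ℝ) :
    ∀ᶠ τ in 𝓝[>] 0, Real.exp (ρ * τ) * (1 - Real.exp (-(a * logScale τ)))
      < putPrice (μ τ.toNNReal) (-(a * logScale τ) + β * τ) := by
  obtain ⟨C, hC⟩ := exists_gt (max β ρ)
  filter_upwards [eventually_add_mul_lt_putPrice_gaussianReal ha hav β C,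
    eventually_exp_mul_sub_one_le ((le_max_left _ _).trans_lt hC),
    eventually_exp_mul_sub_one_le ((le_max_right _ _).trans_lt hC)] with τ hgauss hβ hρ
  have hput := hgauss.trans_le ((hμ τ.toNNReal).putPrice_gaussianReal_le hν hexp _)
  have hle_one : Real.exp (-(a * logScale τ)) ≤ 1 :=
    Real.exp_le_one_iff.2 (neg_nonpos.2 (mul_nonneg ha.le (logScale_nonneg τ)))
  rw [Real.exp_add] at hput
  linarith [mul_le_mul_of_nonneg_left hβ (Real.exp_pos (-(a * logScale τ))).le,
    mul_le_mul_of_nonneg_right hρ (sub_nonneg.2 hle_one)]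

lemma tendsto_div_sub_one_div {ι : Type*} {l : Filter ι} {c y : ι → ℝ} {K σ : ℝ} (hK : 0 < K)
    (hσ : 0 < σ) (hy : Tendsto y l (𝓝[>] 0))
    (hge : ∀ a, σ < a → ∀ᶠ i in l, K * Real.exp (-(a * y i)) ≤ c i)
    (hle : ∀ a, 0 < a → a < σ → ∀ᶠ i in l, c i ≤ K * Real.exp (-(a * y i))) :
    Tendsto (fun i => (K / c i - 1) / y i) l (𝓝 σ) := by
  have hc_pos : ∀ᶠ i in l, 0 < c i :=
    (hge (σ + 1) (by linarith)).mono fun i hi => lt_of_lt_of_le (by positivity) hi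
  have hy_pos : ∀ᶠ i in l, 0 < y i := (tendsto_nhdsWithin_iff.1 hy).2
  refine tendsto_order.2 ⟨fun a ha => ?_, fun a ha => ?_⟩
  · obtain ⟨a', haa', ha'σ⟩ := exists_between (max_lt ha hσ)
    have hslope := ((tendsto_exp_mul_sub_one_div a').comp hy).eventually_const_lt
      ((le_max_left _ _).trans_lt haa')
    filter_upwards [hslope, hle a' ((le_max_right _ _).trans_lt haa') ha'σ, hc_pos, hy_pos]
      with i hslope hci hc hyi
    refine hslope.trans_le ?_
    rw [Real.exp_neg, ← div_eq_mul_inv, le_div_comm₀ hc (Real.exp_pos _)] at hci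
    simp only [Function.comp_apply]
    gcongr
  · obtain ⟨a', hσa', ha'a⟩ := exists_between ha
    have hslope := ((tendsto_exp_mul_sub_one_div a').comp hy).eventually_lt_const ha'a
    filter_upwards [hslope, hge a' hσa', hc_pos, hy_pos] with i hslope hci hc hyi
    refine lt_of_le_of_lt ?_ hslope
    rw [Real.exp_neg, ← div_eq_mul_inv, div_le_comm₀ (Real.exp_pos _) hc] at hci
    simp only [Function.comp_apply]
    gcongr

end SmallTime

section CriticalPrice

lemma lintegral_exp_sub_one_ne_top_of_dConst_pos {r δ : ℝ} {ν : Measure ℝ}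
    (hd : 0 < dConst r δ ν) :
    ∫⁻ x in Ioi (0 : ℝ), ENNReal.ofReal (Real.exp x - 1) ∂ν ≠ ∞ := by
  intro htop
  simp [dConst, htop] at hd

lemma integrableOn_exp_sub_one_of_dConst_pos {r δ : ℝ} {ν : Measure ℝ} (hd : 0 < dConst r δ ν) :
    IntegrableOn (fun x => Real.exp x - 1) (Ioi 0) ν :=
  ⟨by fun_prop, (hasFiniteIntegral_iff_ofReal (ae_exp_sub_one_nonneg ν)).2
    (lintegral_exp_sub_one_ne_top_of_dConst_pos hd).lt_top⟩

lemma setIntegral_exp_sub_one_lt_of_dConst_pos {r δ : ℝ} {ν : Measure ℝ}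
    (hd : 0 < dConst r δ ν) : ∫ x in Ioi 0, (Real.exp x - 1) ∂ν < r - δ := by
  rw [integral_eq_lintegral_of_nonneg_ae (ae_exp_sub_one_nonneg ν) (by fun_prop)]
  have htop := lintegral_exp_sub_one_ne_top_of_dConst_pos hd
  rw [dConst, EReal.sub_pos] at hd
  rwa [← EReal.coe_lt_coe_iff, EReal.coe_ennreal_toReal htop]

variable {Ω : Type*} [MeasurableSpace Ω] {P : Measure Ω} {X : ℝ≥0 → Ω → ℝ} {r δ K T t : ℝ}

lemma euroPut_mul_exp (hX : AEMeasurable (X (T - t).toNNReal) P) (hK : 0 ≤ K) (a : ℝ) :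
    euroPut X P r δ K T t (K * Real.exp a) = Real.exp (-r * (T - t))
      * (K * putPrice (P.map (X (T - t).toNNReal)) (a + (r - δ) * (T - t))) := by
  rw [putPrice, integral_map hX (by fun_prop), euroPut, integral_const_mul, ← integral_const_mul K]
  congr 2 with ω
  rw [putPayoff, mul_max_of_nonneg _ _ hK, mul_zero, mul_assoc, ← Real.exp_add, mul_one_sub,
    add_assoc]

lemma euroPut_zero [IsProbabilityMeasure P] (hK : 0 ≤ K) :
    euroPut X P r δ K T t 0 = Real.exp (-r * (T - t)) * K := by
  simp [euroPut, hK]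

lemma integrable_euroPut_integrand [IsFiniteMeasure P] (hX : AEMeasurable (X (T - t).toNNReal) P)
    {s : ℝ} (hs : 0 ≤ s) :
    Integrable (fun ω => Real.exp (-r * (T - t)) *
      max (K - s * Real.exp ((r - δ) * (T - t) + X (T - t).toNNReal ω)) 0) P := by
  refine .const_mul (.of_bound (by fun_prop) (max K 0) (ae_of_all _ fun ω => ?_)) _
  rw [Real.norm_of_nonneg (le_max_right _ _)]
  exact max_le_max_right _ (sub_le_self _ (by positivity))

lemma convexOn_euroPut [IsFiniteMeasure P] (hX : AEMeasurable (X (T - t).toNNReal) P) :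
    ConvexOn ℝ (Ici 0) (euroPut X P r δ K T t) := by
  refine ⟨convex_Ici 0, fun s hs s' hs' p q hp hq hpq => ?_⟩
  have hint := integrable_euroPut_integrand (r := r) (δ := δ) (K := K) hX hs
  have hint' := integrable_euroPut_integrand (r := r) (δ := δ) (K := K) hX hs'
  simp only [euroPut, smul_eq_mul]
  rw [← integral_const_mul, ← integral_const_mul,
    ← integral_add (hint.const_mul p) (hint'.const_mul q)]
  refine integral_mono (integrable_euroPut_integrand hX
    (add_nonneg (mul_nonneg hp hs) (mul_nonneg hq hs')))
    ((hint.const_mul p).add (hint'.const_mul q)) fun ω => ?_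
  simp only [mul_left_comm p, mul_left_comm q, ← mul_add]
  gcongr
  set E := Real.exp ((r - δ) * (T - t) + X (T - t).toNNReal ω)
  refine max_le ?_ (by positivity)
  calc K - (p * s + q * s') * E = p * (K - s * E) + q * (K - s' * E) := by
        linear_combination -K * hpq
    _ ≤ p * max (K - s * E) 0 + q * max (K - s' * E) 0 := by gcongr <;> exact le_max_left _ _

lemma euroPut_le_sub_of_le [IsProbabilityMeasure P] (hX : AEMeasurable (X (T - t).toNNReal) P)
    (hr : 0 ≤ r) (hK : 0 ≤ K) (ht : t ≤ T) {s s₀ : ℝ} (hs : 0 ≤ s) (hss₀ : s ≤ s₀)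
    (h : euroPut X P r δ K T t s₀ ≤ K - s₀) : euroPut X P r δ K T t s ≤ K - s := by
  have hzero : euroPut X P r δ K T t 0 ≤ K - 0 := by
    rw [euroPut_zero hK, sub_zero]
    exact mul_le_of_le_one_left hK (Real.exp_le_one_iff.2 (by nlinarith))
  have hconvex : ConvexOn ℝ (Ici 0) fun s => euroPut X P r δ K T t s - (K - s) :=
    (convexOn_euroPut hX).sub
      ((concaveOn_const K (convex_Ici 0)).sub (convexOn_id (convex_Ici 0)))
  refine sub_nonpos.1 ((hconvex.le_max_of_mem_Icc self_mem_Ici (hs.trans hss₀) ⟨hs, hss₀⟩).trans ?_)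
  exact max_le (sub_nonpos.2 hzero) (sub_nonpos.2 h)

lemma euroCritPrice_le {s : ℝ} (hs : 0 ≤ s) (hsK : s ≤ K) (h : K - s < euroPut X P r δ K T t s) :
    euroCritPrice X P r δ K T t ≤ s :=
  csInf_le ⟨0, fun _ hs => hs.1⟩ ⟨hs, by rwa [max_eq_left (sub_nonneg.2 hsK)]⟩

lemma le_euroCritPrice [IsProbabilityMeasure P] (hX : AEMeasurable (X (T - t).toNNReal) P)
    (hr : 0 ≤ r) (hK : 0 ≤ K) (ht : t ≤ T) {s s' : ℝ} (h : euroPut X P r δ K T t s ≤ K - s)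
    (hs' : 0 ≤ s') (hs'K : s' ≤ K) (h' : K - s' < euroPut X P r δ K T t s') :
    s ≤ euroCritPrice X P r δ K T t := by
  refine le_csInf ⟨s', hs', by rwa [max_eq_left (sub_nonneg.2 hs'K)]⟩ fun q hq => ?_
  by_contra! hqs
  exact (hq.2.trans_le (euroPut_le_sub_of_le hX hr hK ht hq.1 hqs.le h)).not_ge (le_max_left _ _)

variable {ν : Measure ℝ} {v : ℝ≥0} {a : ℝ}

lemma eventually_euroPut_le_sub [IsProbabilityMeasure P] (hX : ∀ t, AEMeasurable (X t) P)
    (hlaw : ∀ t, IsExpMartingaleLaw v ν t (P.map (X t))) (hν : IsLevyMeasure ν)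
    (hexp : IntegrableOn Real.exp (Ioi 1) ν) (hr : 0 ≤ r) (hK : 0 ≤ K) (hd : 0 < dConst r δ ν)
    (ha : 0 < a) (hav : v < a ^ 2) :
    ∀ᶠ τ in 𝓝[>] 0, euroPut X P r δ K T (T - τ) (K * Real.exp (-(a * logScale τ)))
      ≤ K - K * Real.exp (-(a * logScale τ)) := by
  have hprob (t : ℝ≥0) := Measure.isProbabilityMeasure_map (hX t)
  filter_upwards [eventually_putPrice_le hlaw hν hexp (integrableOn_exp_sub_one_of_dConst_pos hd)
    (setIntegral_exp_sub_one_lt_of_dConst_pos hd) ha hav, self_mem_nhdsWithin] with τ hput hτ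
  have hdiscount : Real.exp (-r * τ) ≤ 1 := Real.exp_le_one_iff.2 (by nlinarith [mem_Ioi.1 hτ])
  rw [euroPut_mul_exp (hX _) hK, sub_sub_cancel, ← mul_one_sub]
  calc _ ≤ K * putPrice (P.map (X τ.toNNReal)) (-(a * logScale τ) + (r - δ) * τ) :=
        mul_le_of_le_one_left (mul_nonneg hK (putPrice_nonneg _ _)) hdiscount
    _ ≤ K * (1 - Real.exp (-(a * logScale τ))) := by gcongr

lemma eventually_sub_lt_euroPut [IsProbabilityMeasure P] (hX : ∀ t, AEMeasurable (X t) P)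
    (hlaw : ∀ t, IsExpMartingaleLaw v ν t (P.map (X t))) (hν : IsLevyMeasure ν)
    (hexp : IntegrableOn Real.exp (Ioi 1) ν) (hK : 0 < K) (ha : 0 < a) (hav : a ^ 2 < v) :
    ∀ᶠ τ in 𝓝[>] 0, K - K * Real.exp (-(a * logScale τ))
      < euroPut X P r δ K T (T - τ) (K * Real.exp (-(a * logScale τ))) := by
  have hprob (t : ℝ≥0) := Measure.isProbabilityMeasure_map (hX t)
  filter_upwards [eventually_lt_putPrice hlaw hν hexp ha hav r (r - δ)] with τ hput
  rw [euroPut_mul_exp (hX _) hK.le, sub_sub_cancel, ← mul_one_sub]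
  calc K * (1 - Real.exp (-(a * logScale τ)))
      = Real.exp (-r * τ) * (K * (Real.exp (r * τ) * (1 - Real.exp (-(a * logScale τ))))) := by
        rw [mul_left_comm, ← mul_assoc (Real.exp _), ← Real.exp_add, neg_mul, neg_add_cancel,
          Real.exp_zero, one_mul]
    _ < Real.exp (-r * τ)
          * (K * putPrice (P.map (X τ.toNNReal)) (-(a * logScale τ) + (r - δ) * τ)) := by gcongr

lemma mul_exp_neg_mul_logScale_le (hK : 0 ≤ K) (ha : 0 ≤ a) (τ : ℝ) :
    K * Real.exp (-(a * logScale τ)) ≤ K :=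
  mul_le_of_le_one_right hK
    (Real.exp_le_one_iff.2 (neg_nonpos.2 (mul_nonneg ha (logScale_nonneg τ))))

lemma eventually_euroCritPrice_le [IsProbabilityMeasure P] (hX : ∀ t, AEMeasurable (X t) P)
    (hlaw : ∀ t, IsExpMartingaleLaw v ν t (P.map (X t))) (hν : IsLevyMeasure ν)
    (hexp : IntegrableOn Real.exp (Ioi 1) ν) (hK : 0 < K) (ha : 0 < a) (hav : a ^ 2 < v) :
    ∀ᶠ τ in 𝓝[>] 0, euroCritPrice X P r δ K T (T - τ) ≤ K * Real.exp (-(a * logScale τ)) :=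
  (eventually_sub_lt_euroPut hX hlaw hν hexp hK ha hav).mono fun τ hlt =>
    euroCritPrice_le (by positivity) (mul_exp_neg_mul_logScale_le hK.le ha.le τ) hlt

lemma eventually_le_euroCritPrice [IsProbabilityMeasure P] (hX : ∀ t, AEMeasurable (X t) P)
    (hlaw : ∀ t, IsExpMartingaleLaw v ν t (P.map (X t))) (hν : IsLevyMeasure ν)
    (hexp : IntegrableOn Real.exp (Ioi 1) ν) (hr : 0 ≤ r) (hK : 0 < K) (hd : 0 < dConst r δ ν)
    (hv : 0 < v) (ha : 0 < a) (hav : v < a ^ 2) :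
    ∀ᶠ τ in 𝓝[>] 0, K * Real.exp (-(a * logScale τ)) ≤ euroCritPrice X P r δ K T (T - τ) := by
  obtain ⟨a', ha', ha'v⟩ := exists_between (Real.sqrt_pos.2 (NNReal.coe_pos.2 hv))
  filter_upwards [eventually_euroPut_le_sub hX hlaw hν hexp hr hK.le hd ha hav,
    eventually_sub_lt_euroPut hX hlaw hν hexp hK ha' ((Real.lt_sqrt ha'.le).1 ha'v),
    self_mem_nhdsWithin] with τ hle hlt hτ
  exact le_euroCritPrice (hX _) hr hK.le (sub_le_self T (mem_Ioi.1 hτ).le) hle (by positivity)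
    (mul_exp_neg_mul_logScale_le hK.le ha'.le τ) hlt

end CriticalPrice

end ExpLevy

end

theorem mainTheorem2_general {Ω : Type*} [MeasurableSpace Ω] (P : Measure Ω)
    [IsProbabilityMeasure P] (X : ℝ≥0 → Ω → ℝ) (b σ : ℝ) (ν : Measure ℝ) (r δ K T : ℝ)
    (hX : ∀ t, AEMeasurable (X t) P) (hν : ExpLevy.IsLevyMeasure ν)
    (hchar : ∀ (t : ℝ≥0) (u : ℝ), charFun (P.map (X t)) u
      = Complex.exp ((t : ℝ) * ExpLevy.levyExponent b (σ ^ 2) ν u))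
    (hmart : ExpLevy.MartingaleCondition b (σ ^ 2) ν) (hr : 0 ≤ r) (hK : 0 < K) (hσ : 0 < σ)
    (hd : 0 < ExpLevy.dConst r δ ν) :
    Tendsto (fun τ : ℝ => ExpLevy.zeta X P r δ K T τ / Real.sqrt (-(τ * Real.log τ)))
      (𝓝[>] 0) (𝓝 σ) := by
  lift σ to ℝ≥0 using hσ.le
  have hexp := hmart.integrableOn_exp
  have hlaw (t : ℝ≥0) : ExpLevy.IsExpMartingaleLaw (σ ^ 2) ν t (P.map (X t)) := fun u => by
    rw [hchar, ← NNReal.coe_pow, ExpLevy.levyExponent_eq_expMartingaleExponent hν hexp]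
    rwa [NNReal.coe_pow]
  refine ExpLevy.tendsto_div_sub_one_div hK hσ
    (tendsto_nhdsWithin_iff.2 ⟨ExpLevy.tendsto_logScale, ExpLevy.eventually_logScale_pos⟩)
    (fun a ha => ?_) fun a ha haσ => ?_
  · exact ExpLevy.eventually_le_euroCritPrice hX hlaw hν hexp hr hK hd (pow_pos hσ 2)
      (hσ.trans ha) (by push_cast; gcongr)
  · exact ExpLevy.eventually_euroCritPrice_le hX hlaw hν hexp hK ha (by push_cast; gcongr)

theorem mainTheorem2 {Ω : Type*} [MeasurableSpace Ω] (P : Measure Ω) [IsProbabilityMeasure P]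
    (X : ℝ≥0 → Ω → ℝ) (b σ : ℝ) (ν : Measure ℝ) (r δ K T : ℝ)
    (hX : ExpLevy.IsLevyProcessWithTriplet X P b (σ ^ 2) ν)
    (hmart : ExpLevy.MartingaleCondition b (σ ^ 2) ν)
    (hr : 0 ≤ r) (hδ : 0 ≤ δ) (hK : 0 < K) (hT : 0 < T)
    (hσ : 0 < σ) (hd : 0 < ExpLevy.dConst r δ ν) :
    Tendsto (fun τ : ℝ => ExpLevy.zeta X P r δ K T τ / Real.sqrt (-(τ * Real.log τ)))
      (𝓝[>] 0) (𝓝 σ) :=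
  mainTheorem2_general P X b σ ν r δ K T (fun t => (hX.isLevyProcess.measurable t).aemeasurable)
    hX.isLevyMeasure hX.charFun_eq hmart hr hK hσ hd
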